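/- Let $G$ be a connected finite graph with edge set $E$ (loops and multiple edges allowed). An orientation of $G$ assigns to each edge one of its two directions (a loop also has two directions). A cycle is a set $C\subseteq E$ of edges $v_1v_2, v_2v_3,\dots,v_nv_1$ with $v_1,\dots,v_n$ distinct, and a cocycle is an inclusion-minimal nonempty cut; traversing a cycle in one of its two ways gives a directed cycle, and directing all edges of a cocycle from one side of the cut to the other gives a directed cocycle. After fixing a reference orientation, orientations are identified with $\{\pm1\}$-vectors, and directed cycles and cocycles with $\{0,\pm1\}$-vectors, indexed by $E$. A cycle signature $\sigma$ chooses a direction $\sigma(C)$ for each cycle $C$; it is acyclic if $\sum_C a_C\,\sigma(C)=0$ in $\mathbb{R}^E$ with all $a_C\ge 0$ implies $a_C=0$ for all $C$. An orientation is $\sigma$-compatible if each directed cycle contained in it is one of the $\sigma(C)$. A cocycle signature $\sigma^*$, its acyclicity and $\sigma^*$-compatibility are defined in the same way with cocycles. Fix an acyclic cycle signature $\sigma$ and an acyclic cocycle signature $\sigma^*$. For a spanning tree $T$ let $g_{\sigma,\sigma^*}(T)$ be the orientation in which each $e\notin T$ is directed as in $\sigma(C)$, where $C$ is the unique cycle in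 $T\cup\{e\}$, and each $e\in T$ is directed as in $\sigma^*(C^*)$, where $C^*$ is the unique cocycle in $(E\setminus T)\cup\{e\}$. For every orientation $O$ there are an orientation $O^{cp}$ that is both $\sigma$-compatible and $\sigma^*$-compatible, pairwise disjoint directed cycles $\{\vec C_i\}_{i\in I}$ and directed cocycles $\{\vec C^*_j\}_{j\in J}$ in $O^{cp}$ whose reversal turns $O^{cp}$ into $O$, and a spanning tree $T$ with $g_{\sigma,\sigma^*}(T)=O^{cp}$; and the set $$\varphi_{\sigma,\sigma^*}(O)=\Bigl(T\cup\biguplus_{i\in I}C_i\Bigr)\setminus\biguplus_{j\in J}C^*_j\subseteq E$$ is the same for all such choices. The resulting map $\varphi_{\sigma,\sigma^*}$ from orientations to spanning subgraphs (subsets of $E$) has the following property: for any two different orientations $O_1$ and $O_2$ of $G$ there is an edge $e$ such that $O_1(e)\neq O_2(e)$ and $e\in\varphi_{\sigma,\sigma^*}(O_1)\bigtriangleup\varphi_{\sigma,\sigma^*}(O_2)$. In particular, $\varphi_{\sigma,\sigma^*}$ is injective. -/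

import Mathlib

/-- A multigraph with vertices `V` and edges `E`, loops and multiple edges allowed, together with a
reference orientation: in the reference orientation the edge `e` goes from `refTail e` to
`refHead e`. -/
structure OrientedMultigraph (V E : Type*) where
  refTail : E → V
  refHead : E → V

namespace OrientedMultigraph

variable {V E : Type*}

/-- The tail of the arc `(e, b)`; `b = true` is the direction of `e` in the reference orientation,
`b = false` the opposite one. A loop has two directions as well. -/
def arcTail (G : OrientedMultigraph V E) (e : E) (b : Bool) : V :=
  if b then G.refTail e else G.refHead e

/-- The head of the arc `(e, b)`. -/
def arcHead (G : OrientedMultigraph V E) (e : E) (b : Bool) : V :=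
  if b then G.refHead e else G.refTail e

/-- The spanning subgraph with edge set `S` is connected. -/
def ConnectedOn (G : OrientedMultigraph V E) (S : Set E) : Prop :=
  Nonempty V ∧ ∀ u w : V, Relation.ReflTransGen
    (fun x y => ∃ e ∈ S, ∃ b : Bool, G.arcTail e b = x ∧ G.arcHead e b = y) u w

/-- The graph is connected. -/
def Connected (G : OrientedMultigraph V E) : Prop := G.ConnectedOn Set.univ

/-- An orientation (a direction for each edge); `true` is the reference direction. -/
abbrev Orientation (_G : OrientedMultigraph V E) : Type _ := E → Bool

/-- The coordinate `±1` of an arc with respect to the reference orientation. -/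
def arcSign (b : Bool) : ℤ := if b then 1 else -1

/-- Directed cycles, written as `{0, ±1}`-vectors: the vertices `v 0, …, v n` are distinct, the
edges `ed 0, …, ed n` are distinct, and `ed i` is directed from `v i` to `v (i + 1)`, where indices
are cyclic. The case `n = 0` is a loop and `n = 1` is a pair of parallel edges. -/
def IsDirectedCycle (G : OrientedMultigraph V E) (c : E → ℤ) : Prop :=
  ∃ (n : ℕ) (v : Fin (n + 1) → V) (ed : Fin (n + 1) → E) (s : Fin (n + 1) → Bool),
    Function.Injective v ∧ Function.Injective ed ∧
    (∀ i, G.arcTail (ed i) (s i) = v i ∧ G.arcHead (ed i) (s i) = v (i + 1)) ∧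
    (∀ i, c (ed i) = arcSign (s i)) ∧ (∀ e, e ∉ Set.range ed → c e = 0)

/-- A cycle is the set of edges underlying a directed cycle. -/
def IsCycle (G : OrientedMultigraph V E) (C : Set E) : Prop :=
  ∃ c, G.IsDirectedCycle c ∧ Function.support c = C

/-- The set of edges with exactly one endpoint in `W`. -/
def cut (G : OrientedMultigraph V E) (W : Set V) : Set E :=
  {e | (G.refTail e ∈ W ∧ G.refHead e ∉ W) ∨ (G.refTail e ∉ W ∧ G.refHead e ∈ W)}

/-- A cocycle is an inclusion-minimal nonempty cut. -/
def IsCocycle (G : OrientedMultigraph V E) (D : Set E) : Prop :=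
  Minimal (fun D' : Set E => D'.Nonempty ∧ ∃ W : Set V, D' = G.cut W) D

open Classical in
/-- The `{0, ±1}`-vector of the cut of `W`, all edges being directed from `W` to its complement. -/
noncomputable def cutVector (G : OrientedMultigraph V E) (W : Set V) : E → ℤ := fun e =>
  if G.refTail e ∈ W ∧ G.refHead e ∉ W then 1
  else if G.refTail e ∉ W ∧ G.refHead e ∈ W then -1
  else 0

/-- Directed cocycles, written as `{0, ±1}`-vectors. Replacing `W` by its complement gives the other
direction. -/
def IsDirectedCocycle (G : OrientedMultigraph V E) (d : E → ℤ) : Prop :=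
  ∃ W : Set V, G.IsCocycle (G.cut W) ∧ d = G.cutVector W

/-- A spanning tree, as a set of edges: connected, and it contains no cycle. -/
def IsSpanningTree (G : OrientedMultigraph V E) (T : Set E) : Prop :=
  G.ConnectedOn T ∧ ∀ C, G.IsCycle C → ¬ C ⊆ T

/-- The choice of a direction for each underlying edge set of an object satisfying `P`. For
`P = G.IsDirectedCycle` this is a cycle signature; for `P = G.IsDirectedCocycle` it is a cocycle
signature. -/
structure Signature (P : (E → ℤ) → Prop) where
  dir : {C : Set E // ∃ c, P c ∧ Function.support c = C} → E → ℤ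
  directed : ∀ C, P (dir C)
  support_dir : ∀ C, Function.support (dir C) = C.1

open Classical in
/-- A signature is acyclic if the only nonnegative linear relation between the chosen directed
objects is the trivial one. -/
def Signature.Acyclic [Fintype E] {P : (E → ℤ) → Prop} (σ : Signature P) : Prop :=
  ∀ a : {C : Set E // ∃ c, P c ∧ Function.support c = C} → ℝ,
    (∀ C, 0 ≤ a C) → (∑ C, a C • (fun e => (σ.dir C e : ℝ))) = 0 → ∀ C, a C = 0

/-- The directed object `c` is in the orientation `O`: they agree on the support of `c`. -/
def InOrientation (c : E → ℤ) (O : E → Bool) : Prop :=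
  ∀ e, c e ≠ 0 → c e = arcSign (O e)

/-- The orientation `O` is compatible with the signature `σ`: each directed cycle (cocycle) in `O`
is one of those chosen by `σ`. -/
def Compatible {P : (E → ℤ) → Prop} (σ : Signature P) (O : E → Bool) : Prop :=
  ∀ c, P c → InOrientation c O → c ∈ Set.range σ.dir

open Classical in
/-- The map `g` from spanning trees to orientations: `e ∉ T` is directed as in `σ(C)` for the cycle
`C ⊆ T ∪ {e}`, and `e ∈ T` is directed as in `τ(D)` for the cocycle `D ⊆ (E \ T) ∪ {e}`. -/
noncomputable def treeOrientation (G : OrientedMultigraph V E) (σ : Signature G.IsDirectedCycle)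
    (τ : Signature G.IsDirectedCocycle) (T : Set E) : G.Orientation := fun e =>
  decide ((e ∉ T ∧ ∃ C, C.1 ⊆ insert e T ∧ σ.dir C e = 1) ∨
    (e ∈ T ∧ ∃ D, D.1 ⊆ insert e Tᶜ ∧ τ.dir D e = 1))

open Classical in
/-- The orientation obtained from `O` by reversing the edges in `P`. -/
noncomputable def reverseOn (P : Set E) (O : E → Bool) : E → Bool :=
  fun e => if e ∈ P then !(O e) else O e

/-- The union of the edge sets underlying a family of directed cycles or cocycles. -/
def edgesOf (𝒞 : Set (E → ℤ)) : Set E := ⋃ c ∈ 𝒞, Function.support c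

/-- `S` is a value of the extended map at `O`: there are a `(σ, τ)`-compatible orientation `Ocp`,
pairwise disjoint directed cycles `𝒞` and directed cocycles `𝒟` in `Ocp` whose reversal turns `Ocp`
into `O`, and a spanning tree `T` with `g(T) = Ocp`, such that `S` is obtained from `T` by adding
the edges of the cycles and deleting the edges of the cocycles. -/
def IsSubgraphValue (G : OrientedMultigraph V E) (σ : Signature G.IsDirectedCycle)
    (τ : Signature G.IsDirectedCocycle) (O : G.Orientation) (S : Set E) : Prop :=
  ∃ (Ocp : G.Orientation) (𝒞 𝒟 : Set (E → ℤ)) (T : Set E),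
    Compatible σ Ocp ∧ Compatible τ Ocp ∧
    (∀ c ∈ 𝒞, G.IsDirectedCycle c ∧ InOrientation c Ocp) ∧
    (∀ d ∈ 𝒟, G.IsDirectedCocycle d ∧ InOrientation d Ocp) ∧
    𝒞.PairwiseDisjoint Function.support ∧ 𝒟.PairwiseDisjoint Function.support ∧
    Disjoint (edgesOf 𝒞) (edgesOf 𝒟) ∧
    O = reverseOn (edgesOf 𝒞 ∪ edgesOf 𝒟) Ocp ∧
    G.IsSpanningTree T ∧ G.treeOrientation σ τ T = Ocp ∧
    S = (T ∪ edgesOf 𝒞) \ edgesOf 𝒟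

/-- The map `φ` from orientations to spanning subgraphs (sets of edges). -/
noncomputable def subgraphMap (G : OrientedMultigraph V E) (σ : Signature G.IsDirectedCycle)
    (τ : Signature G.IsDirectedCocycle) (O : G.Orientation) : Set E :=
  Classical.epsilon (fun S => G.IsSubgraphValue σ τ O S)

end OrientedMultigraph

/-! Everything is reduced to linear algebra on two orthogonal complements in `E → ℝ`: the cycle
space and the cut space. By Farkas, acyclicity yields weights `w`, `w'` such that `σ` and `τ` choose
the direction of positive weight. For a spanning tree `T`, let `u` be the vector of `w + cutSpace`
vanishing on `T`, and `v` the vector of `w' + cycleSpace` vanishing off `T`. The tree orientation is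
the sign of `u` off `T` and of `v` on `T`.

Existence: reversing a circulation and a cut vector of maximal weight makes an orientation
compatible (`Signature.exists_reversal`). In the orthant of a compatible orientation, linear
programming duality (`exists_complementary`) gives such `u`, `v` with disjoint supports, and the
zero set of `u` is the required tree (`exists_treeOrientation_eq`).

Uniqueness and injectivity (`IsSubgraphValue.eq_and_eq`): let `x`, `y` be the signed indicators of
the reversed cycles and cocycles. For large `K`, the vectors `u - K y` and `v - K x` record by their
signs and sizes the orientation, the tree and the subgraph at each edge. For two values of the map,
the differences of these vectors lie in the cut space and in the cycle space, hence are orthogonal.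
If the subgraphs agree wherever the orientations differ, every term of this dot product is
nonpositive (`PerturbedSigns.mul_nonpos`), hence zero. This forces equal subgraphs and equal trees,
and then equal reversed sets, since a tree supports no nonzero circulation and its complement no
nonzero cut vector. -/

/-! ### Farkas' lemma and linear programming duality -/

/-- **Farkas' lemma** for finitely many linear functionals on a real vector space. -/
theorem farkas_finset {W ι : Type*} [AddCommGroup W] [Module ℝ W] (S : Finset ι) :
    ∀ (a : ι → W →ₗ[ℝ] ℝ) (γ : W →ₗ[ℝ] ℝ),
      (∀ x, (∀ i ∈ S, 0 ≤ a i x) → 0 ≤ γ x) →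
      ∃ l : ι → ℝ, (∀ i, 0 ≤ l i) ∧ ∀ x, γ x = ∑ i ∈ S, l i * a i x := by
  classical
  induction S using Finset.induction_on with
  | empty =>
    intro a γ h
    refine ⟨fun _ => 0, fun _ => le_rfl, fun x => ?_⟩
    have h1 := h x (by simp)
    have h2 := h (-x) (by simp)
    simp only [map_neg] at h2
    simp only [Finset.sum_empty]
    linarith
  | insert j S hj ih =>
    intro a γ h
    by_cases hS : ∀ x, (∀ i ∈ S, 0 ≤ a i x) → 0 ≤ γ x
    · obtain ⟨l, hl, hγ⟩ := ih a γ hS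
      refine ⟨fun i => if i = j then 0 else l i, fun i => ?_, fun x => ?_⟩
      · dsimp only
        split_ifs
        · exact le_rfl
        · exact hl i
      · rw [Finset.sum_insert hj, hγ x]
        simp only [if_true, zero_mul, zero_add]
        refine Finset.sum_congr rfl fun i hi => ?_
        rw [if_neg (ne_of_mem_of_not_mem hi hj)]
    · push Not at hS
      obtain ⟨x₀, hx₀, hγ₀⟩ := hS
      have hj₀ : a j x₀ < 0 := by
        by_contra hcon
        push Not at hcon
        refine absurd (h x₀ fun i hi => ?_) (not_le.2 hγ₀)
        rcases Finset.mem_insert.1 hi with rfl | hi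
        · exact hcon
        · exact hx₀ i hi
      have hj₁ : a j x₀ ≠ 0 := hj₀.ne
      -- The new functionals are the old ones composed with the projection onto the kernel of `a j`
      -- along `x₀`.
      obtain ⟨l, hl, hγ⟩ := ih (fun i => a i - (a i x₀ / a j x₀) • a j)
        (γ - (γ x₀ / a j x₀) • a j) (by
          intro x hx
          have key := h (x - (a j x / a j x₀) • x₀) (by
            intro i hi
            rcases Finset.mem_insert.1 hi with rfl | hi
            · simp [hj₁]
            · have := hx i hi
              simp only [LinearMap.sub_apply, LinearMap.smul_apply, smul_eq_mul, map_sub,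
                map_smul] at this ⊢
              convert this using 2
              ring)
          simp only [LinearMap.sub_apply, LinearMap.smul_apply, smul_eq_mul, map_sub,
            map_smul] at key ⊢
          convert key using 2
          ring)
      refine ⟨fun i => if i = j then γ x₀ / a j x₀ - ∑ i ∈ S, l i * (a i x₀ / a j x₀) else l i,
        fun i => ?_, fun x => ?_⟩
      · dsimp only
        split_ifs
        · have h1 : 0 ≤ γ x₀ / a j x₀ := (div_pos_of_neg_of_neg hγ₀ hj₀).le
          have h2 : ∑ i ∈ S, l i * (a i x₀ / a j x₀) ≤ 0 :=
            Finset.sum_nonpos fun i hi =>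
              mul_nonpos_of_nonneg_of_nonpos (hl i) (div_nonpos_of_nonneg_of_nonpos (hx₀ i hi) hj₀.le)
          linarith
        · exact hl i
      · rw [Finset.sum_insert hj]
        have h1 := hγ x
        simp only [LinearMap.sub_apply, LinearMap.smul_apply, smul_eq_mul] at h1
        have h2 : ∑ i ∈ S, (if i = j then γ x₀ / a j x₀ - ∑ i ∈ S, l i * (a i x₀ / a j x₀)
            else l i) * a i x = ∑ i ∈ S, l i * a i x :=
          Finset.sum_congr rfl fun i hi => by rw [if_neg (ne_of_mem_of_not_mem hi hj)]
        dsimp only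
        rw [h2, if_pos rfl, sub_mul, Finset.sum_mul]
        have h3 : ∑ i ∈ S, l i * (a i x - a i x₀ / a j x₀ * a j x) =
            ∑ i ∈ S, l i * a i x - ∑ i ∈ S, l i * (a i x₀ / a j x₀) * a j x := by
          rw [← Finset.sum_sub_distrib]
          exact Finset.sum_congr rfl fun i _ => by ring
        linarith

/-- Finitely many vectors without nontrivial nonnegative linear relation lie in an open half
space. -/
theorem exists_pos_dotProduct {E κ : Type*} [Fintype E] [Fintype κ] (v : κ → E → ℝ)
    (h : ∀ a : κ → ℝ, (∀ k, 0 ≤ a k) → ∑ k, a k • v k = 0 → ∀ k, a k = 0) :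
    ∃ w : E → ℝ, ∀ k, 0 < w ⬝ᵥ v k := by
  classical
  let φ : κ → (E → ℝ) →ₗ[ℝ] ℝ := fun k =>
    { toFun := fun w => w ⬝ᵥ v k
      map_add' := fun a b => add_dotProduct a b (v k)
      map_smul' := fun r a => smul_dotProduct r a (v k) }
  have key : ∀ k, ∃ w : E → ℝ, (∀ l, 0 ≤ w ⬝ᵥ v l) ∧ 0 < w ⬝ᵥ v k := by
    intro k
    by_contra hcon
    push Not at hcon
    obtain ⟨l, hl, hγ⟩ := farkas_finset Finset.univ φ (-φ k) (by
      intro w hw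
      have := hcon w fun l => hw l (Finset.mem_univ l)
      simpa [φ] using this)
    -- Farkas expresses `-v k` as the combination of the `v i` with coefficients `l`, so raising the
    -- coefficient of `v k` by one gives a forbidden relation.
    have := h (l + Pi.single k 1) (fun i => add_nonneg (hl i)
      ((Pi.single_nonneg (i := k) (α := fun _ => ℝ)).2 zero_le_one i)) (by
        ext e
        have := hγ (Pi.single e 1)
        simp only [φ, LinearMap.neg_apply, LinearMap.coe_mk, AddHom.coe_mk,
          single_one_dotProduct] at this
        simp only [Pi.add_apply, add_smul, Finset.sum_add_distrib, Finset.sum_apply, Pi.smul_apply,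
          smul_eq_mul, Pi.zero_apply, ← this, Pi.single_apply, ite_mul, one_mul, zero_mul,
          Finset.sum_ite_eq', Finset.mem_univ, if_true]
        ring) k
    have h1 := hl k
    simp at this
    linarith
  choose w hw hpos using key
  refine ⟨∑ k, w k, fun k => ?_⟩
  rw [sum_dotProduct]
  exact Finset.sum_pos' (fun i _ => hw i k) ⟨k, Finset.mem_univ k, hpos k⟩

/-- **Strong linear programming duality** for complementary orthogonal subspaces, in the orthant
with sign vector `s`: if `w` and `w'` are nonnegative on the parts of `Z` and of `B` in that orthant,
then `w + B` and `w' + Z` contain vectors of the orthant which are complementary. -/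
theorem exists_complementary {E : Type*} [Fintype E] (Z B : Submodule ℝ (E → ℝ))
    (hZB : ∀ x, (∀ y ∈ B, x ⬝ᵥ y = 0) → x ∈ Z) (hBZ : ∀ y, (∀ x ∈ Z, x ⬝ᵥ y = 0) → y ∈ B)
    (hort : ∀ x ∈ Z, ∀ y ∈ B, x ⬝ᵥ y = 0) (s w w' : E → ℝ)
    (hw : ∀ x ∈ Z, (∀ e, 0 ≤ s e * x e) → 0 ≤ w ⬝ᵥ x)
    (hw' : ∀ y ∈ B, (∀ e, 0 ≤ s e * y e) → 0 ≤ w' ⬝ᵥ y) :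
    ∃ u v : E → ℝ, u - w ∈ B ∧ v - w' ∈ Z ∧ (∀ e, 0 ≤ s e * u e) ∧ (∀ e, 0 ≤ s e * v e) ∧
      u ⬝ᵥ v ≤ 0 := by
  classical
  -- Homogenisation: put `u = w + y / t` and `v = w' + x / t`. Since `x ⬝ᵥ y = 0`, the condition `u
  -- ⬝ᵥ v ≤ 0` becomes linear in `(x, y, t)`.
  suffices hsuff : ∃ x ∈ Z, ∃ y ∈ B, ∃ t : ℝ, 0 < t ∧ (∀ e, 0 ≤ s e * (y e + t * w e)) ∧
      (∀ e, 0 ≤ s e * (x e + t * w' e)) ∧ w ⬝ᵥ x + w' ⬝ᵥ y + t * (w ⬝ᵥ w') ≤ 0 by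
    obtain ⟨x, hx, y, hy, t, ht, hu, hv, hgap⟩ := hsuff
    refine ⟨t⁻¹ • y + w, t⁻¹ • x + w', ?_, ?_, fun e => ?_, fun e => ?_, ?_⟩
    · simpa using B.smul_mem t⁻¹ hy
    · simpa using Z.smul_mem t⁻¹ hx
    · have := mul_nonneg (inv_pos.2 ht).le (hu e)
      simp only [Pi.add_apply, Pi.smul_apply, smul_eq_mul]
      calc (0 : ℝ) ≤ _ := this
        _ = _ := by field_simp
    · have := mul_nonneg (inv_pos.2 ht).le (hv e)
      simp only [Pi.add_apply, Pi.smul_apply, smul_eq_mul]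
      calc (0 : ℝ) ≤ _ := this
        _ = _ := by field_simp
    · have h0 := hort x hx y hy
      rw [dotProduct_comm] at h0
      have : t⁻¹ * (w ⬝ᵥ x + w' ⬝ᵥ y + t * (w ⬝ᵥ w')) ≤ 0 :=
        mul_nonpos_of_nonneg_of_nonpos (inv_pos.2 ht).le hgap
      convert this using 1
      simp only [add_dotProduct, dotProduct_add, smul_dotProduct, dotProduct_smul, smul_eq_mul, h0]
      rw [dotProduct_comm y w']
      field_simp
      ring
  by_contra hcon
  let dot : (E → ℝ) → (E → ℝ) →ₗ[ℝ] ℝ := fun z =>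
    { toFun := fun x => z ⬝ᵥ x
      map_add' := fun a b => dotProduct_add z a b
      map_smul' := fun r a => dotProduct_smul r z a }
  let px : (Z × B) × ℝ →ₗ[ℝ] (E → ℝ) := Z.subtype ∘ₗ LinearMap.fst ℝ Z B ∘ₗ LinearMap.fst ℝ _ ℝ
  let py : (Z × B) × ℝ →ₗ[ℝ] (E → ℝ) := B.subtype ∘ₗ LinearMap.snd ℝ Z B ∘ₗ LinearMap.fst ℝ _ ℝ
  let pt : (Z × B) × ℝ →ₗ[ℝ] ℝ := LinearMap.snd ℝ _ ℝ
  let a : (E ⊕ E) ⊕ Bool → (Z × B) × ℝ →ₗ[ℝ] ℝ := Sum.elim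
    (Sum.elim (fun e => s e • (LinearMap.proj e ∘ₗ py + w e • pt))
      (fun e => s e • (LinearMap.proj e ∘ₗ px + w' e • pt)))
    (fun b => if b then pt else -(dot w ∘ₗ px + dot w' ∘ₗ py + (w ⬝ᵥ w') • pt))
  -- Without a solution having `t > 0`, the constraints imply `-t ≥ 0`, so Farkas supplies
  -- multipliers.
  obtain ⟨l, hl, hγ⟩ := farkas_finset Finset.univ a (-pt) (by
    rintro ⟨⟨x, y⟩, t⟩ h
    by_contra ht
    refine hcon ⟨x, x.2, y, y.2, t, ?_, fun e => ?_, fun e => ?_, ?_⟩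
    · simpa [pt] using ht
    · have := h (Sum.inl (Sum.inl e)) (Finset.mem_univ _)
      simpa [a, py, pt, mul_comm, mul_add] using this
    · have := h (Sum.inl (Sum.inr e)) (Finset.mem_univ _)
      simpa [a, px, pt, mul_comm, mul_add] using this
    · have := h (Sum.inr false) (Finset.mem_univ _)
      simp only [a, Sum.elim_inr, Bool.false_eq_true, if_false, LinearMap.neg_apply,
        LinearMap.add_apply, LinearMap.smul_apply, LinearMap.comp_apply, smul_eq_mul] at this
      have h2 : 0 ≤ -(w ⬝ᵥ (x : E → ℝ) + w' ⬝ᵥ (y : E → ℝ) + (w ⬝ᵥ w') * t) := this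
      linarith)
  set lam : E → ℝ := fun e => l (Sum.inl (Sum.inl e)) * s e with hlam
  set mu : E → ℝ := fun e => l (Sum.inl (Sum.inr e)) * s e with hmu
  set rho := l (Sum.inr true)
  set kap := l (Sum.inr false)
  have hid : ∀ x ∈ Z, ∀ y ∈ B, ∀ t : ℝ, -t = lam ⬝ᵥ y + t * (lam ⬝ᵥ w) + mu ⬝ᵥ x + t * (mu ⬝ᵥ w')
      + rho * t - kap * (w ⬝ᵥ x + w' ⬝ᵥ y + (w ⬝ᵥ w') * t) := by
    intro x hx y hy t
    have := hγ ((⟨x, hx⟩, ⟨y, hy⟩), t)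
    simp only [Fintype.sum_sum_type, Fintype.sum_bool] at this
    have h1 : ∑ e, l (Sum.inl (Sum.inl e)) * a (Sum.inl (Sum.inl e)) ((⟨x, hx⟩, ⟨y, hy⟩), t) =
        lam ⬝ᵥ y + t * (lam ⬝ᵥ w) := by
      simp only [dotProduct, Finset.mul_sum, ← Finset.sum_add_distrib]
      refine Finset.sum_congr rfl fun e _ => ?_
      simp [a, py, pt, hlam]
      ring
    have h2 : ∑ e, l (Sum.inl (Sum.inr e)) * a (Sum.inl (Sum.inr e)) ((⟨x, hx⟩, ⟨y, hy⟩), t) =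
        mu ⬝ᵥ x + t * (mu ⬝ᵥ w') := by
      simp only [dotProduct, Finset.mul_sum, ← Finset.sum_add_distrib]
      refine Finset.sum_congr rfl fun e _ => ?_
      simp [a, px, pt, hmu]
      ring
    rw [h1, h2] at this
    have h3 : a (Sum.inr true) ((⟨x, hx⟩, ⟨y, hy⟩), t) = t := by simp [a, pt]
    have h4 : a (Sum.inr false) ((⟨x, hx⟩, ⟨y, hy⟩), t) =
        -(w ⬝ᵥ x + w' ⬝ᵥ y + (w ⬝ᵥ w') * t) := by
      simp only [a, Sum.elim_inr, Bool.false_eq_true, if_false, LinearMap.neg_apply,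
        LinearMap.add_apply, LinearMap.smul_apply, LinearMap.comp_apply, smul_eq_mul]
      rfl
    rw [h3, h4] at this
    simp only [LinearMap.neg_apply] at this
    have h5 : pt ((⟨x, hx⟩, ⟨y, hy⟩), t) = t := rfl
    rw [h5] at this
    linarith
  -- The system is self-dual: its multipliers satisfy the same system with `kap` in place of `t`.
  have hx : lam - kap • w' ∈ Z := by
    refine hZB _ fun y hy => ?_
    have := hid 0 Z.zero_mem y hy 0
    simp only [dotProduct_zero] at this
    rw [sub_dotProduct, smul_dotProduct, smul_eq_mul]
    linarith
  have hy : mu - kap • w ∈ B := by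
    refine hBZ _ fun x hx => ?_
    have := hid x hx 0 B.zero_mem 0
    simp only [dotProduct_zero] at this
    rw [dotProduct_sub, dotProduct_smul, smul_eq_mul, dotProduct_comm x mu, dotProduct_comm x w]
    linarith
  have hgap := hid 0 Z.zero_mem 0 B.zero_mem 1
  simp only [dotProduct_zero] at hgap
  have hgap' : w ⬝ᵥ (lam - kap • w') + w' ⬝ᵥ (mu - kap • w) + kap * (w ⬝ᵥ w') = -1 - rho := by
    simp only [dotProduct_sub, dotProduct_smul, smul_eq_mul]
    rw [dotProduct_comm w lam, dotProduct_comm w' mu, dotProduct_comm w' w]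
    linarith
  have hrho : 0 ≤ rho := hl _
  have hsl : ∀ e, 0 ≤ s e * lam e := fun e => by
    have := mul_nonneg (hl (Sum.inl (Sum.inl e))) (mul_self_nonneg (s e))
    simp only [hlam]
    linarith
  have hsm : ∀ e, 0 ≤ s e * mu e := fun e => by
    have := mul_nonneg (hl (Sum.inl (Sum.inr e))) (mul_self_nonneg (s e))
    simp only [hmu]
    linarith
  -- If `kap > 0`, the multipliers are themselves an excluded solution. If `kap = 0`, then `lam ∈ Z`
  -- and `mu ∈ B` lie in the orthant with total weight `-1 - rho < 0`, against `hw` and `hw'`.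
  rcases (hl (Sum.inr false)).lt_or_eq with hk | hk
  · exact hcon ⟨_, hx, _, hy, kap, hk, fun e => by simpa using hsm e, fun e => by simpa using hsl e,
      by linarith⟩
  · change 0 = kap at hk
    rw [← hk] at hgap' hx hy
    have h1 := hw _ hx fun e => by simpa using hsl e
    have h2 := hw' _ hy fun e => by simpa using hsm e
    linarith

/-! ### Elementary vectors of a subspace, signatures and bases -/

namespace OrientedMultigraph

theorem arcSign_eq (b : Bool) : arcSign b = 1 ∨ arcSign b = -1 := by
  cases b <;> simp [arcSign]

theorem arcSign_injective : Function.Injective arcSign := by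
  intro a b
  cases a <;> cases b <;> simp [arcSign]

theorem arcSign_not (b : Bool) : arcSign (!b) = -arcSign b := by
  cases b <;> simp [arcSign]

/-- An integer vector, regarded as a real vector. -/
def realVec {E : Type*} (c : E → ℤ) : E → ℝ := fun e => (c e : ℝ)

theorem realVec_sub {E : Type*} (c d : E → ℤ) : realVec (c - d) = realVec c - realVec d := by
  ext e
  simp [realVec]

/-- The vectors satisfying `P` are the elementary (support-minimal, `{0, ±1}`-valued) vectors of the
subspace `M`. -/
structure IsElementarySystem {E : Type*} (P : (E → ℤ) → Prop) (M : Submodule ℝ (E → ℝ)) : Prop where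
  mem : ∀ c, P c → realVec c ∈ M
  ne_zero : ∀ c, P c → c ≠ 0
  values : ∀ c, P c → ∀ e, c e = 0 ∨ c e = 1 ∨ c e = -1
  exists_conformal : ∀ x ∈ M, x ≠ 0 → ∃ c, P c ∧ ∀ e, c e ≠ 0 → 0 < (c e : ℝ) * x e
  eq_or_eq_neg : ∀ c c', P c → P c' → Function.support c = Function.support c' → c = c' ∨ c = -c'

/-- `T` is a maximal set containing the support of no vector satisfying `P`. -/
structure IsBasisFor {E : Type*} (P : (E → ℤ) → Prop) (T : Set E) : Prop where
  not_subset : ∀ c, P c → ¬ Function.support c ⊆ T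
  exists_subset_insert : ∀ e ∉ T, ∃ c, P c ∧ Function.support c ⊆ insert e T

section

variable {E : Type*} {P P' : (E → ℤ) → Prop} {M M' : Submodule ℝ (E → ℝ)}

/-- A nonzero `x` would have a conformal elementary vector, whose support would again lie in `T`. -/
theorem IsElementarySystem.eq_zero_of_support_subset (hS : IsElementarySystem P M) {T : Set E}
    (hT : IsBasisFor P T) {x : E → ℝ} (hx : x ∈ M) (hsup : ∀ e ∉ T, x e = 0) : x = 0 := by
  by_contra h0
  obtain ⟨c, hc, hcx⟩ := hS.exists_conformal x hx h0
  refine hT.not_subset c hc fun e he => ?_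
  by_contra heT
  have := hcx e he
  rw [hsup e heT, mul_zero] at this
  exact lt_irrefl _ this

theorem IsElementarySystem.eq_of_mul_pos (hS : IsElementarySystem P M) {c : E → ℤ} (hc : P c)
    {e : E} {b : Bool} {t : ℝ} (h0 : 0 < (c e : ℝ) * t) (h1 : 0 ≤ (arcSign b : ℝ) * t) :
    c e = arcSign b := by
  rcases hS.values c hc e with h | h | h <;> rcases arcSign_eq b with h' | h' <;>
    rw [h] at h0 ⊢ <;> rw [h'] at h1 ⊢ <;> push_cast at h0 h1 <;> first | rfl | (exfalso; linarith)

section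

variable [Fintype E]

/-- This is the only form in which acyclicity is used. -/
theorem Signature.Acyclic.exists_pos {σ : Signature P} (hσ : σ.Acyclic) :
    ∃ w : E → ℝ, ∀ C, 0 < w ⬝ᵥ realVec (σ.dir C) := by
  classical
  refine exists_pos_dotProduct (fun C => realVec (σ.dir C)) fun a ha h => hσ a ha ?_
  convert h
  rfl

/-- A compatible orientation makes the weight nonnegative on the part of the subspace in its
orthant. -/
theorem Compatible.dotProduct_nonneg (hS : IsElementarySystem P M) {σ : Signature P} {w : E → ℝ}
    (hw : ∀ C, 0 < w ⬝ᵥ realVec (σ.dir C)) {O : E → Bool} (hO : Compatible σ O) {x : E → ℝ}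
    (hx : x ∈ M) (hxO : ∀ e, 0 ≤ (arcSign (O e) : ℝ) * x e) : 0 ≤ w ⬝ᵥ x := by
  classical
  induction hn : (Finset.univ.filter fun e => x e ≠ 0).card using Nat.strong_induction_on
    generalizing x with
  | _ n ih =>
    subst hn
    by_cases h0 : x = 0
    · simp [h0]
    obtain ⟨c, hc, hcx⟩ := hS.exists_conformal x hx h0
    have hcO : InOrientation c O := fun e he => hS.eq_of_mul_pos hc (hcx e he) (hxO e)
    obtain ⟨C, rfl⟩ := hO c hc hcO
    set c := σ.dir C
    have hne : (Finset.univ.filter fun e => c e ≠ 0).Nonempty := by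
      obtain ⟨e, he⟩ := Function.ne_iff.1 (hS.ne_zero c hc)
      exact ⟨e, by simpa using he⟩
    -- Subtracting `c` with the smallest absolute value of `x` on its support keeps `x` in the
    -- orthant and kills the coordinate `e₀`.
    obtain ⟨e₀, he₀, hmin⟩ := Finset.exists_min_image _ (fun e => |x e|) hne
    simp only [Finset.mem_filter, Finset.mem_univ, true_and] at he₀ hmin
    have habs : ∀ e, c e ≠ 0 → x e = |x e| * c e := by
      intro e he
      have hp := hcx e he
      rcases hS.values c hc e with h | h | h
      · exact absurd h he
      · rw [h] at hp ⊢
        push_cast at hp ⊢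
        rw [abs_of_pos (by linarith)]
        ring
      · rw [h] at hp ⊢
        push_cast at hp ⊢
        rw [abs_of_neg (by linarith)]
        ring
    have hx' : x - |x e₀| • realVec c ∈ M := M.sub_mem hx (M.smul_mem _ (hS.mem c hc))
    have hval : ∀ e, (x - |x e₀| • realVec c) e = x e - |x e₀| * c e := fun e => rfl
    have hlt := ih _ (Finset.card_lt_card (s := Finset.univ.filter fun e =>
        (x - |x e₀| • realVec c) e ≠ 0) (t := Finset.univ.filter fun e => x e ≠ 0) (by
      rw [Finset.ssubset_iff_of_subset]
      · refine ⟨e₀, ?_, ?_⟩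
        · simp only [Finset.mem_filter, Finset.mem_univ, true_and]
          intro h
          have := hcx e₀ he₀
          rw [h, mul_zero] at this
          exact lt_irrefl _ this
        · simp only [Finset.mem_filter, Finset.mem_univ, true_and, not_not, hval]
          linarith [habs e₀ he₀]
      · intro e
        simp only [Finset.mem_filter, Finset.mem_univ, true_and, hval]
        intro h hxe
        apply h
        have : c e = 0 := by
          by_contra hce
          have := hcx e hce
          rw [hxe, mul_zero] at this
          exact lt_irrefl _ this
        rw [hxe, this]
        simp)) hx' (by
      intro e
      rw [hval]
      by_cases hce : c e = 0
      · rw [hce]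
        simpa using hxO e
      · have h1 := hcO e hce
        have h2 := hmin e hce
        rw [habs e hce, h1, ← sub_mul, mul_left_comm]
        exact mul_nonneg (by linarith) (mul_self_nonneg _)) rfl
    have := mul_nonneg (abs_nonneg (x e₀)) (hw C).le
    rw [dotProduct_sub, dotProduct_smul, smul_eq_mul] at hlt
    linarith

/-- An integral `{0, ±1}`-vector of the subspace is a conformal sum of elementary vectors with
pairwise disjoint supports. -/
theorem IsElementarySystem.exists_decomposition (hS : IsElementarySystem P M) {x : E → ℤ}
    (hx : realVec x ∈ M) (hval : ∀ e, x e = 0 ∨ x e = 1 ∨ x e = -1) :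
    ∃ 𝒞 : Set (E → ℤ), (∀ c ∈ 𝒞, P c ∧ ∀ e, c e ≠ 0 → c e = x e) ∧
      𝒞.PairwiseDisjoint Function.support ∧ edgesOf 𝒞 = Function.support x := by
  classical
  induction hn : (Finset.univ.filter fun e => x e ≠ 0).card using Nat.strong_induction_on
    generalizing x with
  | _ n ih =>
    subst hn
    by_cases h0 : x = 0
    · exact ⟨∅, by simp, by simp, by simp [edgesOf, h0]⟩
    have h0' : realVec x ≠ 0 := by
      intro h
      apply h0
      ext e
      have := congrFun h e
      simpa [realVec] using this
    obtain ⟨c, hc, hcx⟩ := hS.exists_conformal _ hx h0'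
    have hce : ∀ e, c e ≠ 0 → c e = x e := by
      intro e he
      have hp := hcx e he
      simp only [realVec] at hp
      norm_cast at hp
      rcases hS.values c hc e with h | h | h <;> rcases hval e with h' | h' | h' <;>
        rw [h, h'] at hp <;> rw [h, h'] <;> simp at hp
    obtain ⟨e₀, he₀ : c e₀ ≠ 0⟩ := Function.ne_iff.1 (hS.ne_zero c hc)
    have hsub : ∀ e, c e = 0 ∧ (x - c) e = x e ∨ c e ≠ 0 ∧ (x - c) e = 0 := by
      intro e
      by_cases he : c e = 0
      · left
        simp [he]
      · right
        simp [he, ← hce e he]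
    obtain ⟨𝒞, h1, h2, h3⟩ := ih _ (Finset.card_lt_card (s := Finset.univ.filter fun e =>
        (x - c) e ≠ 0) (t := Finset.univ.filter fun e => x e ≠ 0) (by
      rw [Finset.ssubset_iff_of_subset]
      · refine ⟨e₀, ?_, ?_⟩
        · simp only [Finset.mem_filter, Finset.mem_univ, true_and]
          rw [← hce e₀ he₀]
          exact he₀
        · simp only [Finset.mem_filter, Finset.mem_univ, true_and, not_not]
          rcases hsub e₀ with h | h
          · exact absurd h.1 he₀
          · exact h.2
      · intro e
        simp only [Finset.mem_filter, Finset.mem_univ, true_and]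
        rcases hsub e with h | h
        · rw [h.2]
          exact id
        · exact fun h' => absurd h.2 h')) (x := x - c)
      (by rw [realVec_sub]; exact M.sub_mem hx (hS.mem c hc)) (by
        intro e
        rcases hsub e with h | h
        · rw [h.2]
          exact hval e
        · exact Or.inl h.2) rfl
    have hdis : ∀ d ∈ 𝒞, Disjoint (Function.support c) (Function.support d) := by
      intro d hd
      rw [Set.disjoint_left]
      intro e he hde
      rcases hsub e with h | h
      · exact he h.1
      · exact hde (((h1 d hd).2 e hde).trans h.2)
    refine ⟨insert c 𝒞, ?_, ?_, ?_⟩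
    · rintro d (rfl | hd)
      · exact ⟨hc, hce⟩
      · refine ⟨(h1 d hd).1, fun e he => ?_⟩
        have := (h1 d hd).2 e he
        rcases hsub e with h | h
        · rw [this, h.2]
        · exact absurd (this.trans h.2) he
    · refine h2.insert fun d hd _ => hdis d hd
    · have : edgesOf (insert c 𝒞) = Function.support c ∪ edgesOf 𝒞 := by
        simp [edgesOf]
      rw [this, h3]
      ext e
      simp only [Set.mem_union, Function.mem_support]
      rcases hsub e with h | h
      · rw [h.2, h.1]
        simp
      · have := h.1
        rw [← hce e h.1]
        tauto

/-- The vector supported on the edges of a disjoint family of elementary vectors in an orientation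
lies in the subspace. -/
theorem IsElementarySystem.indicator_edgesOf_mem (hS : IsElementarySystem P M) {O : E → Bool}
    {𝒞 : Set (E → ℤ)} (h𝒞 : ∀ c ∈ 𝒞, P c ∧ InOrientation c O)
    (hdis : 𝒞.PairwiseDisjoint Function.support) :
    (edgesOf 𝒞).indicator (fun e => (arcSign (O e) : ℝ)) ∈ M := by
  classical
  have hfin : 𝒞.Finite := by
    refine Set.Finite.subset (Set.Finite.pi' (t := fun _ : E => ({0, 1, -1} : Set ℤ))
      fun _ => Set.toFinite _) fun c hc e => ?_
    simpa using hS.values c (h𝒞 c hc).1 e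
  have hsum : (edgesOf 𝒞).indicator (fun e => (arcSign (O e) : ℝ)) =
      ∑ c ∈ hfin.toFinset, realVec c := by
    ext e
    rw [Finset.sum_apply]
    by_cases he : e ∈ edgesOf 𝒞
    · rw [Set.indicator_of_mem he]
      obtain ⟨c, hc, hce⟩ := Set.mem_iUnion₂.1 he
      rw [Finset.sum_eq_single c]
      · rw [← (h𝒞 c hc).2 e hce]
        rfl
      · intro d hd hdc
        have := hdis (hfin.mem_toFinset.1 hd) hc hdc
        by_contra hcon
        exact Set.disjoint_left.1 this (show d e ≠ 0 by simpa [realVec] using hcon) hce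
      · intro h
        exact absurd (hfin.mem_toFinset.2 hc) h
    · rw [Set.indicator_of_notMem he]
      refine (Finset.sum_eq_zero fun c hc => ?_).symm
      by_contra hcon
      exact he (Set.mem_iUnion₂.2 ⟨c, hfin.mem_toFinset.1 hc, by simpa [realVec] using hcon⟩)
  rw [hsum]
  exact M.sum_mem fun c hc => hS.mem c (h𝒞 c (hfin.mem_toFinset.1 hc)).1

/-- Reversing the support of a suitable vector of the subspace makes an orientation compatible. -/
theorem Signature.exists_reversal (hS : IsElementarySystem P M) {σ : Signature P} {w : E → ℝ}
    (hw : ∀ C, 0 < w ⬝ᵥ realVec (σ.dir C)) (O : E → Bool) :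
    ∃ x : E → ℤ, realVec x ∈ M ∧ (∀ e, x e = 0 ∨ x e = -arcSign (O e)) ∧
      ∀ c, P c → (∀ e, c e ≠ 0 → c e = arcSign (O e) + 2 * x e) → c ∈ Set.range σ.dir := by
  classical
  -- Adding `2 * x` to the sign vector of `O` reverses the support of `x`; among such `x` in `M` one
  -- of maximal weight is taken.
  let F : Finset (E → ℤ) := (Fintype.piFinset fun e => {0, -arcSign (O e)}).filter
    fun x => realVec x ∈ M
  have hF : ∀ x, x ∈ F ↔ (∀ e, x e = 0 ∨ x e = -arcSign (O e)) ∧ realVec x ∈ M := by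
    intro x
    simp [F, Fintype.mem_piFinset]
  obtain ⟨x, hxF, hmax⟩ := Finset.exists_max_image F (fun x => w ⬝ᵥ realVec x)
    ⟨0, (hF 0).2 ⟨fun e => Or.inl rfl, by
      convert M.zero_mem
      ext e
      simp [realVec]⟩⟩
  have hx := (hF x).1 hxF
  refine ⟨x, hx.2, hx.1, fun c hc hcO => ?_⟩
  by_contra hcon
  set C : {C : Set E // ∃ c, P c ∧ Function.support c = C} := ⟨Function.support c, c, hc, rfl⟩
  have hneg : σ.dir C = -c := by
    rcases hS.eq_or_eq_neg _ c (σ.directed C) hc (σ.support_dir C) with h | h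
    · exact absurd ⟨C, h⟩ hcon
    · exact h
  have hpos := hw C
  have hneg' : realVec (σ.dir C) = -realVec c := by
    rw [hneg]
    ext e
    simp [realVec]
  rw [hneg', dotProduct_neg] at hpos
  -- Reversing the unchosen `c` as well stays in `F`, and `-c` has positive weight, against
  -- maximality.
  have hmem : x - c ∈ F := by
    refine (hF _).2 ⟨fun e => ?_, ?_⟩
    · by_cases he : c e = 0
      · simpa [he] using hx.1 e
      · have := hcO e he
        rcases hx.1 e with h | h
        · right
          simp [this, h]
        · left
          simp only [Pi.sub_apply, this, h]
          ring
    · rw [realVec_sub]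
      exact M.sub_mem hx.2 (hS.mem c hc)
  have := hmax _ hmem
  simp only [realVec_sub, dotProduct_sub] at this
  linarith

/-- The weight can be changed by a vector of the complementary subspace so as to vanish on a
basis. -/
theorem IsElementarySystem.exists_sub_mem_vanishing (hS : IsElementarySystem P M) {T : Set E}
    (hT : IsBasisFor P Tᶜ) (w : E → ℝ) : ∃ u : E → ℝ, u - w ∈ M ∧ ∀ e ∈ T, u e = 0 := by
  classical
  -- Rescaled fundamental vectors restrict on `T` to the standard basis, so they can cancel `w`
  -- there.
  have hd : ∀ e, ∃ d ∈ M, e ∈ T → d e = 1 ∧ ∀ f ∈ T, f ≠ e → d f = 0 := by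
    intro e
    by_cases he : e ∈ T
    · obtain ⟨c, hc, hce⟩ := hT.exists_subset_insert e (by simpa using he)
      have h0 : c e ≠ 0 := by
        intro h0
        refine hT.not_subset c hc fun f hf => ?_
        rcases hce hf with rfl | h
        · exact absurd h0 hf
        · exact h
      refine ⟨(c e : ℝ)⁻¹ • realVec c, M.smul_mem _ (hS.mem c hc), fun _ => ⟨?_, fun f hf hfe => ?_⟩⟩
      · have : (c e : ℝ) ≠ 0 := by exact_mod_cast h0
        simp [realVec, this]
      · have : c f = 0 := by
          by_contra hcf
          rcases hce hcf with h | h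
          · exact hfe h
          · exact h hf
        simp [realVec, this]
    · exact ⟨0, M.zero_mem, fun h => absurd h he⟩
  choose d hdM hdT using hd
  refine ⟨w - ∑ e ∈ Finset.univ.filter (· ∈ T), w e • d e, ?_, fun f hf => ?_⟩
  · rw [sub_sub_cancel_left]
    exact M.neg_mem (M.sum_mem fun e _ => M.smul_mem _ (hdM e))
  · rw [Pi.sub_apply, Finset.sum_apply, Finset.sum_eq_single f]
    · simp [(hdT f hf).1]
    · intro e he hef
      simp only [Finset.mem_filter, Finset.mem_univ, true_and] at he
      simp [(hdT e he).2 f hf hef.symm]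
    · intro h
      simp [hf] at h

/-- Moving `w` to `u` inside `M'` does not change the pairing with `σ.dir C`, and only the term at
`e` survives in it. -/
theorem mul_dir_pos (hS : IsElementarySystem P M) (hort : ∀ x ∈ M, ∀ y ∈ M', x ⬝ᵥ y = 0)
    {σ : Signature P} {w : E → ℝ} (hw : ∀ C, 0 < w ⬝ᵥ realVec (σ.dir C)) {T : Set E} {u : E → ℝ}
    (hu : u - w ∈ M') (huT : ∀ e ∈ T, u e = 0) {e : E}
    {C : {C : Set E // ∃ c, P c ∧ Function.support c = C}} (hC : C.1 ⊆ insert e T) :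
    0 < u e * σ.dir C e := by
  classical
  have h0 := hort _ (hS.mem _ (σ.directed C)) _ hu
  rw [dotProduct_sub, dotProduct_comm _ w, sub_eq_zero] at h0
  have h1 := hw C
  rw [← h0, dotProduct, Finset.sum_eq_single e] at h1
  · rw [mul_comm]
    exact h1
  · intro f _ hfe
    by_cases hf : σ.dir C f = 0
    · simp [realVec, hf]
    · have : f ∈ C.1 := by
        rw [← σ.support_dir C]
        exact hf
      rcases hC this with h | h
      · exact absurd h hfe
      · simp [huT f h]
  · simp

/-- Off a basis, the direction given by the fundamental elementary vectors is the sign of the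
reduced weight. -/
theorem exists_dir_eq_one_iff (hS : IsElementarySystem P M)
    (hort : ∀ x ∈ M, ∀ y ∈ M', x ⬝ᵥ y = 0)
    {σ : Signature P} {w : E → ℝ} (hw : ∀ C, 0 < w ⬝ᵥ realVec (σ.dir C)) {T : Set E}
    (hT : IsBasisFor P T) {u : E → ℝ}
    (hu : u - w ∈ M') (huT : ∀ e ∈ T, u e = 0) {e : E} (he : e ∉ T) :
    u e ≠ 0 ∧ ((∃ C, C.1 ⊆ insert e T ∧ σ.dir C e = 1) ↔ 0 < u e) := by
  obtain ⟨c, hc, hce⟩ := hT.exists_subset_insert e he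
  have h1 := mul_dir_pos hS hort hw hu huT (C := ⟨Function.support c, c, hc, rfl⟩) hce
  refine ⟨fun h => by simp [h] at h1, ⟨?_, fun h => ⟨⟨Function.support c, c, hc, rfl⟩, hce, ?_⟩⟩⟩
  · rintro ⟨C, hC, hC1⟩
    have := mul_dir_pos hS hort hw hu huT hC
    simpa [hC1] using this
  · rcases hS.values _ (σ.directed ⟨Function.support c, c, hc, rfl⟩) e with h' | h' | h'
    · simp [h'] at h1
    · exact h'
    · rw [h'] at h1
      push_cast at h1
      linarith

end

end

/-! ### The cut space and its cocycles -/

variable {V E : Type*}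

theorem arcSign_mul_sub (G : OrientedMultigraph V E) (f : V → ℝ) (e : E) (b : Bool) :
    (arcSign b : ℝ) * (f (G.refHead e) - f (G.refTail e)) =
      f (G.arcHead e b) - f (G.arcTail e b) := by
  cases b <;> simp [arcSign, arcHead, arcTail]

/-- The cut space: the differences of potentials. -/
def cutSpace (G : OrientedMultigraph V E) : Submodule ℝ (E → ℝ) where
  carrier := {y | ∃ f : V → ℝ, ∀ e, y e = f (G.refTail e) - f (G.refHead e)}
  add_mem' := by
    rintro a b ⟨f, hf⟩ ⟨g, hg⟩
    exact ⟨f + g, fun e => by simp only [Pi.add_apply, hf, hg]; ring⟩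
  zero_mem' := ⟨0, fun e => by simp⟩
  smul_mem' := by
    rintro r a ⟨f, hf⟩
    exact ⟨r • f, fun e => by simp only [Pi.smul_apply, smul_eq_mul, hf]; ring⟩

theorem mem_cut {G : OrientedMultigraph V E} {W : Set V} {e : E} :
    e ∈ G.cut W ↔ (G.refTail e ∈ W ∧ G.refHead e ∉ W) ∨ (G.refTail e ∉ W ∧ G.refHead e ∈ W) :=
  Iff.rfl

theorem support_cutVector (G : OrientedMultigraph V E) (W : Set V) :
    Function.support (G.cutVector W) = G.cut W := by
  ext e
  rw [Function.mem_support, mem_cut, cutVector]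
  split_ifs <;> simp_all

theorem cutVector_values (G : OrientedMultigraph V E) (W : Set V) (e : E) :
    G.cutVector W e = 0 ∨ G.cutVector W e = 1 ∨ G.cutVector W e = -1 := by
  rw [cutVector]
  split_ifs <;> simp

theorem realVec_cutVector_mem (G : OrientedMultigraph V E) (W : Set V) :
    realVec (G.cutVector W) ∈ G.cutSpace := by
  classical
  refine ⟨fun v => if v ∈ W then 1 else 0, fun e => ?_⟩
  by_cases h1 : G.refTail e ∈ W <;> by_cases h2 : G.refHead e ∈ W <;>
    simp [realVec, cutVector, h1, h2]

/-- The directed cut of `W` conforms to `y`. -/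
def CutConforms (G : OrientedMultigraph V E) (W : Set V) (y : E → ℝ) : Prop :=
  ∀ e, (G.refTail e ∈ W → G.refHead e ∉ W → 0 < y e) ∧
    (G.refTail e ∉ W → G.refHead e ∈ W → y e < 0)

theorem CutConforms.mul_pos {G : OrientedMultigraph V E} {W : Set V} {y : E → ℝ}
    (h : G.CutConforms W y) (e : E) (he : G.cutVector W e ≠ 0) :
    0 < (G.cutVector W e : ℝ) * y e := by
  have := h e
  rw [cutVector] at he ⊢
  split_ifs at he ⊢ with h1 h2
  · simpa using this.1 h1.1 h1.2
  · simpa using this.2 h2.1 h2.2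
  · exact absurd rfl he

/-- A conformal nonempty cut contains a conformal cocycle. -/
theorem CutConforms.exists_isCocycle [Finite E] {G : OrientedMultigraph V E} {y : E → ℝ}
    {W : Set V} (hne : (G.cut W).Nonempty) (h : G.CutConforms W y) :
    ∃ W', G.IsCocycle (G.cut W') ∧ G.CutConforms W' y := by
  induction hn : (G.cut W).ncard using Nat.strong_induction_on generalizing W with
  | _ n ih =>
    subst hn
    by_cases hW : G.IsCocycle (G.cut W)
    · exact ⟨W, hW, h⟩
    suffices hsuff : ∃ W', (G.cut W').Nonempty ∧ G.CutConforms W' y ∧ G.cut W' ⊂ G.cut W by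
      obtain ⟨W', h1, h2, h3⟩ := hsuff
      exact ih _ (Set.ncard_lt_ncard h3 (Set.toFinite _)) h1 h2 rfl
    have : ∃ W', (G.cut W').Nonempty ∧ G.cut W' ⊆ G.cut W ∧ ¬ G.cut W ⊆ G.cut W' := by
      by_contra hcon
      push Not at hcon
      refine hW ⟨⟨hne, W, rfl⟩, ?_⟩
      rintro _ ⟨h1, W', rfl⟩ h2
      exact hcon W' h1 h2
    obtain ⟨W', ⟨e₁, he₁⟩, hsub, hnsub⟩ := this
    obtain ⟨e₂, he₂, he₂'⟩ := Set.not_subset.1 hnsub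
    -- No edge joins `W ∩ W'` to `W \ W'`, or `W' \ W` to the outside of both: `W'` would cut it and
    -- `W` would not. So `W ∩ W'` and `W ∪ W'` have conformal cuts inside that of `W`, and one of
    -- these is nonempty and proper.
    have hedge : ∀ e, e ∈ G.cut W' → e ∈ G.cut W := fun e he => hsub he
    have hinter : G.CutConforms (W ∩ W') y := by
      intro e
      have h1 := hedge e
      have h2 := h e
      simp only [mem_cut, Set.mem_inter_iff] at h1 h2 ⊢
      clear * - h1 h2
      grind
    have hunion : G.CutConforms (W ∪ W') y := by
      intro e
      have h1 := hedge e
      have h2 := h e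
      simp only [mem_cut, Set.mem_union] at h1 h2 ⊢
      clear * - h1 h2
      grind
    have hinter' : G.cut (W ∩ W') ⊆ G.cut W := by
      intro e
      have h1 := hedge e
      simp only [mem_cut, Set.mem_inter_iff] at h1 ⊢
      clear * - h1
      grind
    have hunion' : G.cut (W ∪ W') ⊆ G.cut W := by
      intro e
      have h1 := hedge e
      simp only [mem_cut, Set.mem_union] at h1 ⊢
      clear * - h1
      grind
    have h1 := hedge e₁
    have h2 := hedge e₂
    by_cases hA : (G.cut (W ∩ W')).Nonempty
    · by_cases hB : (G.cut (W \ W')).Nonempty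
      · refine ⟨W ∩ W', hA, hinter, hinter', fun hcon => ?_⟩
        obtain ⟨e, he⟩ := hB
        have h3 := hedge e
        have h4 := @hcon e
        simp only [mem_cut, Set.mem_inter_iff, Set.mem_sdiff] at he h3 h4
        clear * - he h3 h4
        grind
      · have hB' : ∀ e, e ∉ G.cut (W \ W') := fun e he => hB ⟨e, he⟩
        have h3 := hB' e₁
        have h4 := hB' e₂
        refine ⟨W ∪ W', ⟨e₁, ?_⟩, hunion, hunion', fun hcon => ?_⟩
        · simp only [mem_cut, Set.mem_union, Set.mem_sdiff] at h1 h2 h3 h4 he₁ he₂' ⊢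
          clear * - h1 h2 h3 h4 he₁ he₂'
          grind
        · have h5 := @hcon e₂
          simp only [mem_cut, Set.mem_union, Set.mem_sdiff] at h1 h2 h3 h4 h5 he₂ he₂'
          clear * - h1 h2 h3 h4 h5 he₂ he₂'
          grind
    · have hA' : ∀ e, e ∉ G.cut (W ∩ W') := fun e he => hA ⟨e, he⟩
      have h3 := hA' e₁
      have h4 := hA' e₂
      refine ⟨W ∪ W', ⟨e₂, ?_⟩, hunion, hunion', fun hcon => ?_⟩
      · simp only [mem_cut, Set.mem_union, Set.mem_inter_iff] at h1 h2 h3 h4 he₂ he₂' ⊢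
        clear * - h1 h2 h3 h4 he₂ he₂'
        grind
      · have h5 := @hcon e₁
        simp only [mem_cut, Set.mem_union, Set.mem_inter_iff] at h1 h2 h3 h4 h5 he₁
        clear * - h1 h2 h3 h4 h5 he₁
        grind

/-- Along the cut of a superlevel set the potential drops. The threshold at the higher end of an
edge with `y ≠ 0` makes the cut nonempty. -/
theorem exists_directedCocycle_conformal [Finite E] (G : OrientedMultigraph V E) {y : E → ℝ}
    (hy : y ∈ G.cutSpace) (h0 : y ≠ 0) :
    ∃ d, G.IsDirectedCocycle d ∧ ∀ e, d e ≠ 0 → 0 < (d e : ℝ) * y e := by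
  obtain ⟨f, hf⟩ := hy
  obtain ⟨e₀, he₀ : y e₀ ≠ 0⟩ := Function.ne_iff.1 h0
  have hconf : G.CutConforms {v | max (f (G.refTail e₀)) (f (G.refHead e₀)) ≤ f v} y := by
    intro e
    rw [hf e]
    simp only [Set.mem_ofPred_eq, not_le]
    exact ⟨fun h1 h2 => by linarith, fun h1 h2 => by linarith⟩
  obtain ⟨W, hW, hWy⟩ := hconf.exists_isCocycle ⟨e₀, by
    rw [hf e₀] at he₀
    simp only [mem_cut, Set.mem_ofPred_eq, not_le]
    rcases lt_or_gt_of_ne (sub_ne_zero.1 he₀) with h | h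
    · right
      simp [h, h.le]
    · left
      simp [h, h.le]⟩
  exact ⟨_, ⟨W, hW, rfl⟩, hWy.mul_pos⟩

theorem isElementarySystem_cocycle [Finite E] (G : OrientedMultigraph V E) :
    IsElementarySystem G.IsDirectedCocycle G.cutSpace where
  mem := by
    rintro _ ⟨W, -, rfl⟩
    exact G.realVec_cutVector_mem W
  ne_zero := by
    rintro _ ⟨W, hW, rfl⟩ h0
    have := hW.1.1
    rw [← support_cutVector, h0] at this
    simp at this
  values := by
    rintro _ ⟨W, -, rfl⟩
    exact G.cutVector_values W
  exists_conformal := fun x hx h0 => G.exists_directedCocycle_conformal hx h0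
  eq_or_eq_neg := by
    rintro _ _ ⟨W, hW, rfl⟩ ⟨W', hW', rfl⟩ hs
    obtain ⟨e₀, he₀⟩ := hW.1.1
    have he₁ : G.cutVector W e₀ ≠ 0 := by
      rw [← support_cutVector] at he₀
      exact he₀
    have he₂ : G.cutVector W' e₀ ≠ 0 := by
      rw [← support_cutVector, hs] at he₀
      exact he₀
    obtain ⟨t, ht, hte⟩ : ∃ t : ℤ, (t = 1 ∨ t = -1) ∧
        G.cutVector W e₀ = t * G.cutVector W' e₀ := by
      rcases G.cutVector_values W e₀ with h | h | h <;>
        rcases G.cutVector_values W' e₀ with h' | h' | h' <;> simp_all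
    -- The sign `t` makes the difference vanish at `e₀`; a cocycle conformal to it would lie in
    -- `G.cut W` and miss `e₀`, against minimality.
    have key : realVec (G.cutVector W) - (t : ℝ) • realVec (G.cutVector W') = 0 := by
      by_contra hne
      obtain ⟨_, ⟨W'', hW'', rfl⟩, hd⟩ := G.exists_directedCocycle_conformal
        (G.cutSpace.sub_mem (G.realVec_cutVector_mem W)
          (G.cutSpace.smul_mem (t : ℝ) (G.realVec_cutVector_mem W'))) hne
      have hsub : G.cut W'' ⊆ G.cut W := by
        intro e he
        rw [← support_cutVector] at he ⊢
        by_contra hcon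
        have h1 : G.cutVector W e = 0 := by simpa using hcon
        have h2 : G.cutVector W' e = 0 := by
          rw [hs] at hcon
          simpa using hcon
        have := hd e he
        simp [realVec, h1, h2] at this
      have := hW.2 hW''.1 hsub he₀
      rw [← support_cutVector] at this
      have := hd e₀ this
      simp only [realVec, Pi.sub_apply, Pi.smul_apply, smul_eq_mul, hte] at this
      push_cast at this
      simp at this
    have hfin : ∀ e, G.cutVector W e = t * G.cutVector W' e := by
      intro e
      have := congrFun key e
      simp only [realVec, Pi.sub_apply, Pi.smul_apply, smul_eq_mul, Pi.zero_apply] at this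
      exact_mod_cast sub_eq_zero.1 this
    rcases ht with rfl | rfl
    · left
      ext e
      simpa using hfin e
    · right
      ext e
      simpa using hfin e

/-! ### The cycle space and its cycles -/

section

variable [Fintype E]

/-- The cycle space: the real circulations. -/
def cycleSpace (G : OrientedMultigraph V E) : Submodule ℝ (E → ℝ) where
  carrier := {x | ∀ f : V → ℝ, ∑ e, x e * (f (G.refHead e) - f (G.refTail e)) = 0}
  add_mem' := by
    intro a b ha hb f
    simp only [Pi.add_apply, add_mul, Finset.sum_add_distrib, ha f, hb f, add_zero]
  zero_mem' := by
    intro f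
    simp
  smul_mem' := by
    intro r a ha f
    simp only [Pi.smul_apply, smul_eq_mul, mul_assoc, ← Finset.mul_sum, ha f, mul_zero]

theorem dotProduct_eq_zero_of_mem {G : OrientedMultigraph V E} {x y : E → ℝ}
    (hx : x ∈ G.cycleSpace) (hy : y ∈ G.cutSpace) : x ⬝ᵥ y = 0 := by
  obtain ⟨f, hf⟩ := hy
  have := hx f
  rw [← neg_eq_zero, ← Finset.sum_neg_distrib] at this
  rw [← this]
  exact Finset.sum_congr rfl fun e _ => by rw [hf]; ring

theorem dotProduct_comm_eq_zero_of_mem {G : OrientedMultigraph V E} {x y : E → ℝ} (hy : y ∈ G.cutSpace)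
    (hx : x ∈ G.cycleSpace) : y ⬝ᵥ x = 0 := by
  rw [dotProduct_comm]
  exact dotProduct_eq_zero_of_mem hx hy

theorem mem_cycleSpace_of_orthogonal {G : OrientedMultigraph V E} {x : E → ℝ}
    (h : ∀ y ∈ G.cutSpace, x ⬝ᵥ y = 0) : x ∈ G.cycleSpace := by
  intro f
  have := h (fun e => f (G.refHead e) - f (G.refTail e)) ⟨-f, fun e => by simp; ring⟩
  exact this

/-- A functional separating `y` from the cut space is the dot product with a vector orthogonal to
the cut space, that is, with a circulation. -/
theorem mem_cutSpace_of_orthogonal {G : OrientedMultigraph V E} {y : E → ℝ}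
    (h : ∀ x ∈ G.cycleSpace, x ⬝ᵥ y = 0) : y ∈ G.cutSpace := by
  classical
  by_contra hy
  obtain ⟨φ, hφ, hφ0⟩ := Submodule.exists_le_ker_of_notMem hy
  have hrep : ∀ z : E → ℝ, φ z = (fun e => φ (Pi.single e 1)) ⬝ᵥ z := by
    intro z
    conv_lhs => rw [← Finset.univ_sum_single z]
    rw [map_sum]
    refine Finset.sum_congr rfl fun e _ => ?_
    rw [show (Pi.single e (z e) : E → ℝ) = z e • Pi.single e 1 by
      rw [← Pi.single_smul, smul_eq_mul, mul_one], map_smul, smul_eq_mul, mul_comm]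
  refine hφ ?_
  rw [hrep]
  exact h _ (mem_cycleSpace_of_orthogonal fun z hz => by rw [← hrep]; exact hφ0 hz)

theorem sum_mul_eq_sum_range {n : ℕ} (G : OrientedMultigraph V E) {v : Fin (n + 1) → V}
    {ed : Fin (n + 1) → E} {s : Fin (n + 1) → Bool} (hed : Function.Injective ed)
    (harc : ∀ i, G.arcTail (ed i) (s i) = v i ∧ G.arcHead (ed i) (s i) = v (i + 1))
    {x : E → ℝ} (hx : ∀ e, e ∉ Set.range ed → x e = 0) (f : V → ℝ) :
    ∑ e, x e * (f (G.refHead e) - f (G.refTail e)) =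
      ∑ i, x (ed i) * arcSign (s i) * (f (v (i + 1)) - f (v i)) := by
  refine (Fintype.sum_of_injective ed hed _ _ (fun e he => by rw [hx e he, zero_mul])
    fun i => ?_).symm
  rw [← (harc i).1, ← (harc i).2, ← arcSign_mul_sub, mul_assoc, ← mul_assoc (arcSign (s i) : ℝ)]
  congr 1
  rcases arcSign_eq (s i) with h | h <;> rw [h] <;> simp

theorem IsDirectedCycle.realVec_mem {G : OrientedMultigraph V E} {c : E → ℤ}
    (hc : G.IsDirectedCycle c) : realVec c ∈ G.cycleSpace := by
  obtain ⟨n, v, ed, s, -, hed, harc, hce, hc0⟩ := hc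
  intro f
  rw [G.sum_mul_eq_sum_range hed harc (fun e he => by simp [realVec, hc0 e he])]
  have h1 : ∀ i, realVec c (ed i) * arcSign (s i) = 1 := by
    intro i
    simp only [realVec, hce i]
    rcases arcSign_eq (s i) with h | h <;> rw [h] <;> simp
  simp only [h1, one_mul, Finset.sum_sub_distrib]
  rw [sub_eq_zero]
  exact Equiv.sum_comp (Equiv.addRight (1 : Fin (n + 1))) fun i => f (v i)

/-- Conservation at each vertex `v (j + 1)` equates the flow on consecutive edges of the cycle. -/
theorem IsDirectedCycle.exists_smul_eq {G : OrientedMultigraph V E} {c : E → ℤ}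
    (hc : G.IsDirectedCycle c) {x : E → ℝ} (hx : x ∈ G.cycleSpace)
    (hsup : ∀ e, c e = 0 → x e = 0) : ∃ t : ℝ, ∀ e, x e = t * c e := by
  classical
  obtain ⟨n, v, ed, s, hv, hed, harc, hce, hc0⟩ := hc
  have hstep : ∀ j, x (ed j) * arcSign (s j) = x (ed (j + 1)) * arcSign (s (j + 1)) := by
    intro j
    have := hx (Pi.single (v (j + 1)) 1)
    rw [G.sum_mul_eq_sum_range hed harc (fun e he => hsup e (hc0 e he))] at this
    simp only [mul_sub, Finset.sum_sub_distrib, Pi.single_apply, hv.eq_iff, add_left_inj, mul_ite,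
      mul_one, mul_zero, Finset.sum_ite_eq', Finset.mem_univ, if_true] at this
    linarith
  have hconst : ∀ j, x (ed j) * arcSign (s j) = x (ed 0) * arcSign (s 0) := by
    intro j
    induction j using Fin.induction with
    | zero => rfl
    | succ i ih => rw [← ih, hstep i.castSucc, Fin.coeSucc_eq_succ]
  refine ⟨x (ed 0) * arcSign (s 0), fun e => ?_⟩
  by_cases he : e ∈ Set.range ed
  · obtain ⟨j, rfl⟩ := he
    rw [← hconst j, hce j, mul_assoc]
    rcases arcSign_eq (s j) with h | h <;> rw [h] <;> simp
  · rw [hc0 e he, hsup e (hc0 e he)]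
    simp

/-- Direct each edge of the support by the sign of `x`. By conservation one can always leave the
vertex just entered, and following out-edges among finitely many vertices ends in a directed cycle.
-/
theorem exists_directedCycle_conformal [Finite V] (G : OrientedMultigraph V E) {x : E → ℝ}
    (hx : x ∈ G.cycleSpace) (h0 : x ≠ 0) :
    ∃ c, G.IsDirectedCycle c ∧ ∀ e, c e ≠ 0 → 0 < (c e : ℝ) * x e := by
  classical
  let b : E → Bool := fun e => decide (0 < x e)
  have hb : ∀ e, x e = |x e| * arcSign (b e) := by
    intro e
    by_cases h : 0 < x e
    · simp [b, h, arcSign, abs_of_pos h]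
    · simp [b, h, arcSign, abs_of_nonpos (not_lt.1 h)]
  let A : Set V := {a | ∃ e, x e ≠ 0 ∧ G.arcTail e (b e) = a}
  have hnext : ∀ e, x e ≠ 0 → G.arcHead e (b e) ∈ A := by
    intro e he
    -- With no out-edge at this head, its net inflow is a sum of nonnegative terms, the one of `e`
    -- being positive.
    by_contra hcon
    have hsum := hx (Pi.single (G.arcHead e (b e)) 1)
    have hterm : ∀ e', x e' * ((Pi.single (G.arcHead e (b e)) 1 : V → ℝ) (G.refHead e') -
        (Pi.single (G.arcHead e (b e)) 1 : V → ℝ) (G.refTail e')) =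
        |x e'| * (Pi.single (G.arcHead e (b e)) 1 : V → ℝ) (G.arcHead e' (b e')) := by
      intro e'
      rw [hb e', mul_assoc, arcSign_mul_sub, ← hb e']
      by_cases h' : x e' = 0
      · simp [h']
      · have : G.arcTail e' (b e') ≠ G.arcHead e (b e) := fun h => hcon ⟨e', h', h⟩
        rw [Pi.single_eq_of_ne this, sub_zero]
    rw [Finset.sum_congr rfl fun e' _ => hterm e', Finset.sum_eq_zero_iff_of_nonneg] at hsum
    · have := hsum e (Finset.mem_univ e)
      simp [he] at this
    · intro e' _
      refine mul_nonneg (abs_nonneg _) ?_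
      rw [Pi.single_apply]
      split_ifs <;> norm_num
  obtain ⟨e₀, he₀ : x e₀ ≠ 0⟩ := Function.ne_iff.1 h0
  have hA : ∀ a : A, ∃ e, x e ≠ 0 ∧ G.arcTail e (b e) = a := fun a => a.2
  choose out hout htail using hA
  let F : A → A := fun a => ⟨G.arcHead (out a) (b (out a)), hnext _ (hout a)⟩
  obtain ⟨a, ha⟩ : ∃ a, a ∈ Function.periodicPts F := by
    obtain ⟨m, n, hmn, h⟩ := Finite.exists_ne_map_eq_of_infinite
      fun k : ℕ => F^[k] ⟨_, e₀, he₀, rfl⟩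
    wlog hlt : m < n generalizing m n
    · exact this n m hmn.symm h.symm (lt_of_le_of_ne (not_lt.1 hlt) hmn.symm)
    refine ⟨_, Function.mk_mem_periodicPts (Nat.sub_pos_of_lt hlt)
      (x := F^[m] ⟨_, e₀, he₀, rfl⟩) ?_⟩
    rw [Function.IsPeriodicPt, Function.IsFixedPt, ← Function.iterate_add_apply,
      Nat.sub_add_cancel hlt.le]
    exact h.symm
  -- The cycle has `n + 1` vertices, the minimal period, so they are distinct and the cyclic
  -- successor in `Fin (n + 1)` is `F`.
  obtain ⟨n, hn⟩ := Nat.exists_eq_succ_of_ne_zero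
    (Function.minimalPeriod_pos_of_mem_periodicPts ha).ne'
  let v : Fin (n + 1) → A := fun i => F^[i] a
  have hv : Function.Injective v := by
    intro i j hij
    refine Fin.ext (Function.iterate_injOn_Iio_minimalPeriod (f := F) (x := a) ?_ ?_ hij)
    · rw [hn]
      exact i.2
    · rw [hn]
      exact j.2
  have hvsucc : ∀ i, v (i + 1) = F (v i) := by
    intro i
    have h1 : ((i + 1 : Fin (n + 1)) : ℕ) = (i + 1) % Function.minimalPeriod F a := by
      rw [hn, Fin.val_add]
      simp
    change F^[((i + 1 : Fin (n + 1)) : ℕ)] a = F (F^[i] a)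
    rw [h1, Function.iterate_mod_minimalPeriod_eq, Function.iterate_succ_apply']
  refine ⟨fun e => if e ∈ Set.range fun i => out (v i) then arcSign (b e) else 0,
    ⟨n, fun i => v i, fun i => out (v i), fun i => b (out (v i)),
      Subtype.val_injective.comp hv, fun i j hij => hv (Subtype.ext ?_), fun i => ⟨htail _, ?_⟩,
      fun i => if_pos ⟨i, rfl⟩, fun e he => if_neg he⟩, fun e he => ?_⟩
  · rw [← htail (v i), ← htail (v j)]
    simp only at hij
    rw [hij]
  · exact congrArg Subtype.val (hvsucc i).symm
  · simp only [ne_eq, ite_eq_right_iff, not_forall] at he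
    obtain ⟨⟨i, rfl⟩, -⟩ := he
    dsimp only
    rw [if_pos ⟨i, rfl⟩]
    have h1 := abs_pos.2 (hout (v i))
    conv_rhs => rw [hb (out (v i))]
    rcases arcSign_eq (b (out (v i))) with h | h <;> rw [h] <;> simpa using h1

theorem isElementarySystem_cycle [Finite V] (G : OrientedMultigraph V E) :
    IsElementarySystem G.IsDirectedCycle G.cycleSpace where
  mem := fun c hc => hc.realVec_mem
  ne_zero := by
    rintro c ⟨n, v, ed, s, -, -, -, hce, -⟩ rfl
    have := hce 0
    rcases arcSign_eq (s 0) with h | h <;> simp [h] at this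
  values := by
    rintro c ⟨n, v, ed, s, -, -, -, hce, hc0⟩ e
    by_cases he : e ∈ Set.range ed
    · obtain ⟨i, rfl⟩ := he
      rw [hce i]
      exact Or.inr (arcSign_eq _)
    · exact Or.inl (hc0 e he)
  exists_conformal := fun x hx h0 => G.exists_directedCycle_conformal hx h0
  eq_or_eq_neg := by
    intro c c' hc hc' hs
    obtain ⟨t, ht⟩ := hc'.exists_smul_eq hc.realVec_mem (fun e he => by
      have : e ∉ Function.support c := by simp [hs, he]
      have : c e = 0 := by simpa using this
      simp [realVec, this])
    obtain ⟨n, v, ed, s, -, -, -, hce, -⟩ := hc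
    obtain ⟨n', v', ed', s', -, -, -, hce', hc0'⟩ := hc'
    have h0 : ed 0 ∈ Set.range ed' := by
      by_contra hcon
      have h1 : ed 0 ∉ Function.support c := by
        rw [hs]
        simp [hc0' _ hcon]
      rw [Function.mem_support, not_not, hce] at h1
      rcases arcSign_eq (s 0) with h | h <;> simp [h] at h1
    obtain ⟨i, hi⟩ := h0
    have h1 := ht (ed 0)
    simp only [realVec, hce 0] at h1
    rw [← hi, hce' i] at h1
    have h2 : t = 1 ∨ t = -1 := by
      rcases arcSign_eq (s 0) with h | h <;> rcases arcSign_eq (s' i) with h' | h' <;>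
        rw [h, h'] at h1 <;> push_cast at h1 <;>
        first | (left; linarith) | (right; linarith)
    rcases h2 with rfl | rfl
    · left
      ext e
      have := ht e
      simp only [realVec, one_mul] at this
      exact_mod_cast this
    · right
      ext e
      have := ht e
      simp only [realVec, neg_mul, one_mul] at this
      exact_mod_cast this

end

/-! ### Reachability and spanning trees -/

/-- `w` can be reached from `u` along edges of `S`. -/
def Reaches (G : OrientedMultigraph V E) (S : Set E) (u w : V) : Prop :=
  Relation.ReflTransGen
    (fun x y => ∃ e ∈ S, ∃ b : Bool, G.arcTail e b = x ∧ G.arcHead e b = y) u w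

theorem Reaches.mem_iff {G : OrientedMultigraph V E} {S : Set E} {u w : V} (h : G.Reaches S u w)
    {W : Set V} (hW : Disjoint (G.cut W) S) : u ∈ W ↔ w ∈ W := by
  induction h with
  | refl => rfl
  | tail _ hstep ih =>
    obtain ⟨e, he, b, rfl, rfl⟩ := hstep
    rw [ih]
    have : e ∉ G.cut W := fun h => Set.disjoint_left.1 hW h he
    rw [mem_cut] at this
    cases b <;> simp only [arcTail, arcHead, if_true, if_false, Bool.false_eq_true] <;> tauto

theorem disjoint_cut_setOf_reaches (G : OrientedMultigraph V E) (S : Set E) (u : V) :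
    Disjoint (G.cut {w | G.Reaches S u w}) S := by
  rw [Set.disjoint_left]
  rintro e (⟨h1, h2⟩ | ⟨h1, h2⟩) he
  · exact h2 (Relation.ReflTransGen.tail h1 ⟨e, he, true, rfl, rfl⟩)
  · exact h1 (Relation.ReflTransGen.tail h2 ⟨e, he, false, rfl, rfl⟩)

/-- The signed sum of the edges of a walk is a unit flow from `u` to `w`, tested against potentials.
-/
theorem Reaches.exists_flow [Fintype E] {G : OrientedMultigraph V E} {S : Set E} {u w : V}
    (h : G.Reaches S u w) : ∃ x : E → ℝ, (∀ e ∉ S, x e = 0) ∧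
      ∀ f : V → ℝ, ∑ e, x e * (f (G.refHead e) - f (G.refTail e)) = f w - f u := by
  classical
  induction h with
  | refl => exact ⟨0, fun _ _ => rfl, fun f => by simp⟩
  | tail _ hstep ih =>
    obtain ⟨e, he, b, rfl, rfl⟩ := hstep
    obtain ⟨x, hxS, hx⟩ := ih
    refine ⟨x + Pi.single e (arcSign b : ℝ), fun e' he' => ?_, fun f => ?_⟩
    · rw [Pi.add_apply, hxS e' he', Pi.single_eq_of_ne (fun h => he' (by rwa [h])), add_zero]
    · simp only [Pi.add_apply, add_mul, Finset.sum_add_distrib, hx f, Pi.single_apply, ite_mul,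
        zero_mul, Finset.sum_ite_eq', Finset.mem_univ, if_true, arcSign_mul_sub]
      ring

/-- An edge whose ends are joined outside of it lies on a cycle. -/
theorem Reaches.exists_directedCycle [Finite V] [Fintype E] {G : OrientedMultigraph V E} {S : Set E}
    {e : E} (he : e ∉ S) (h : G.Reaches S (G.refHead e) (G.refTail e)) :
    ∃ c, G.IsDirectedCycle c ∧ Function.support c ⊆ insert e S := by
  classical
  obtain ⟨x, hxS, hx⟩ := h.exists_flow
  have hmem : x + Pi.single e (1 : ℝ) ∈ G.cycleSpace := by
    intro f
    simp only [Pi.add_apply, add_mul, Finset.sum_add_distrib, hx f, Pi.single_apply, ite_mul,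
        zero_mul, one_mul, Finset.sum_ite_eq', Finset.mem_univ, if_true]
    ring
  obtain ⟨c, hc, hcx⟩ := G.exists_directedCycle_conformal hmem (fun h0 => by
    have := congrFun h0 e
    simp [hxS e he] at this)
  refine ⟨c, hc, fun e' he' => ?_⟩
  by_contra hcon
  rw [Set.mem_insert_iff, not_or] at hcon
  have := hcx e' he'
  simp [hxS e' hcon.2, Pi.single_eq_of_ne hcon.1] at this

theorem exists_directedCocycle_subset_cut [Finite E] (G : OrientedMultigraph V E) {W : Set V}
    (h : (G.cut W).Nonempty) : ∃ d, G.IsDirectedCocycle d ∧ Function.support d ⊆ G.cut W := by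
  obtain ⟨e₀, he₀⟩ := h
  obtain ⟨d, hd, hdW⟩ := G.exists_directedCocycle_conformal (G.realVec_cutVector_mem W)
    (fun h0 => by
      rw [← support_cutVector] at he₀
      have := congrFun h0 e₀
      simp only [realVec, Pi.zero_apply] at this
      exact he₀ (by exact_mod_cast this))
  refine ⟨d, hd, fun e he => ?_⟩
  rw [← support_cutVector]
  intro h0
  have := hdW e he
  simp [realVec, h0] at this

section

variable [Finite V] [Fintype E] {G : OrientedMultigraph V E} {T : Set E}

theorem IsSpanningTree.isBasisFor_cycle (hT : G.IsSpanningTree T) :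
    IsBasisFor G.IsDirectedCycle T where
  not_subset := fun c hc => hT.2 _ ⟨c, hc, rfl⟩
  exists_subset_insert := fun _ he => Reaches.exists_directedCycle he (hT.1.2 _ _)

theorem IsSpanningTree.isBasisFor_cocycle (hT : G.IsSpanningTree T) :
    IsBasisFor G.IsDirectedCocycle Tᶜ where
  not_subset := by
    rintro _ ⟨W, hW, rfl⟩ hsub
    rw [support_cutVector] at hsub
    obtain ⟨e, he⟩ := hW.1.1
    have hdis : Disjoint (G.cut W) T :=
      Set.disjoint_left.2 fun e' he' => hsub he'
    have := Reaches.mem_iff (hT.1.2 (G.refTail e) (G.refHead e)) hdis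
    rw [mem_cut] at he
    tauto
  exists_subset_insert := by
    intro e he
    rw [Set.mem_compl_iff, not_not] at he
    -- The fundamental cocycle lies in the cut of the component of `T \ {e}` at the head of `e`; the
    -- tail is outside, as otherwise `T` would contain a cycle.
    set W : Set V := {w | G.Reaches (T \ {e}) (G.refHead e) w} with hWdef
    have hdis := G.disjoint_cut_setOf_reaches (T \ {e}) (G.refHead e)
    rw [← hWdef] at hdis
    have h1 : G.refHead e ∈ W := Relation.ReflTransGen.refl
    have h2 : G.refTail e ∉ W := by
      intro h
      obtain ⟨c, hc, hce⟩ := Reaches.exists_directedCycle (by simp) h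
      exact hT.2 _ ⟨c, hc, rfl⟩ (by simpa [Set.insert_eq_of_mem he] using hce)
    obtain ⟨d, hd, hdW⟩ := G.exists_directedCocycle_subset_cut (W := W) ⟨e, Or.inr ⟨h2, h1⟩⟩
    refine ⟨d, hd, fun e' he' => ?_⟩
    have := Set.disjoint_left.1 hdis (hdW he')
    by_cases h : e' = e
    · exact Or.inl h
    · exact Or.inr fun h' => this ⟨h', h⟩

end

/-- If `T` were not connected, the cut of one of its components would be nonempty by connectedness
of `G`, and would contain a cocycle avoiding `T`. -/
theorem isSpanningTree_of_not_subset [Finite E] {G : OrientedMultigraph V E}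
    {T : Set E} (hG : G.Connected)
    (hcyc : ∀ c, G.IsDirectedCycle c → ¬ Function.support c ⊆ T)
    (hcoc : ∀ d, G.IsDirectedCocycle d → ¬ Function.support d ⊆ Tᶜ) : G.IsSpanningTree T := by
  refine ⟨⟨hG.1, fun u w => ?_⟩, ?_⟩
  · by_contra hcon
    have hdis := G.disjoint_cut_setOf_reaches T u
    have hne : (G.cut {w | G.Reaches T u w}).Nonempty := by
      by_contra hne
      rw [Set.not_nonempty_iff_eq_empty] at hne
      have := Reaches.mem_iff (hG.2 u w) (W := {w | G.Reaches T u w}) (by simp [hne])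
      exact hcon (this.1 Relation.ReflTransGen.refl)
    obtain ⟨d, hd, hsub⟩ := G.exists_directedCocycle_subset_cut hne
    exact hcoc d hd fun e he => Set.disjoint_left.1 hdis (hsub he)
  · rintro _ ⟨c, hc, rfl⟩
    exact hcyc c hc

/-! ### Sign patterns of perturbed weights -/

/-- The sign pattern at an edge, relative to its direction, of the two reduced weights perturbed by
`K` times the reversed cocycles and cycles; `t` means that the edge is in the tree, and `s` that it
is in the associated subgraph. -/
structure PerturbedSigns (s t : Prop) (K a b : ℝ) : Prop where
  of_mem : s → 0 < b ∧ (t → a = 0 ∧ b < K) ∧ (¬ t → a < 0 ∧ b = K)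
  of_notMem : ¬ s → 0 < a ∧ (¬ t → b = 0 ∧ a < K) ∧ (t → b < 0 ∧ a = K)

/-- The duality between cycles and cocycles; it halves the case analysis below. -/
theorem PerturbedSigns.swap {s t : Prop} {K a b : ℝ} (h : PerturbedSigns s t K a b) :
    PerturbedSigns (¬ s) (¬ t) K b a where
  of_mem := fun hs => ⟨(h.of_notMem hs).1, (h.of_notMem hs).2.1,
    fun ht => (h.of_notMem hs).2.2 (not_not.1 ht)⟩
  of_notMem := fun hs => ⟨(h.of_mem (not_not.1 hs)).1,
    fun ht => (h.of_mem (not_not.1 hs)).2.1 (not_not.1 ht), (h.of_mem (not_not.1 hs)).2.2⟩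

/-- Here `x` and `y` say that the edge lies on a reversed cycle or cocycle, `o` is its sign before
and `r` after the reversal. Reversal negates `o * u` and `o * v`, and the perturbation then adds `K`
to the second on a cycle, to the first on a cocycle. -/
theorem perturbedSigns_of_state {t x y : Prop} {r o u v K α β : ℝ} (hxy : ¬ (x ∧ y))
    (ho : o = 1 ∨ o = -1) (hr : x ∨ y → r = -o) (hr' : ¬ (x ∨ y) → r = o)
    (hut : t → u = 0) (hu : ¬ t → 0 < o * u ∧ o * u < K)
    (hvt : ¬ t → v = 0) (hv : t → 0 < o * v ∧ o * v < K)
    (hα : y → α = K * o) (hα' : ¬ y → α = 0) (hβ : x → β = K * o) (hβ' : ¬ x → β = 0) :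
    PerturbedSigns ((t ∨ x) ∧ ¬ y) t K (r * (u - α)) (r * (v - β)) := by
  have hoo : o * o = 1 := by rcases ho with rfl | rfl <;> norm_num
  by_cases ht : t <;> by_cases hx : x <;> by_cases hy : y <;>
    simp only [ht, hx, hy, true_or, or_true, or_self, and_self, not_true_eq_false, not_false_eq_true,
      forall_const, false_implies, and_true, and_false] at * <;>
    subst_vars <;>
    refine ⟨?_, ?_⟩ <;>
    simp only [not_true_eq_false, not_false_eq_true, false_implies, and_true, true_and,
      forall_const] <;>
    rcases ho with rfl | rfl <;> constructor <;> (try constructor) <;> linarith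

/-- The admissible points `(a, b)` lie on a decreasing staircase, with `a ≤ 0 < b` if `s` holds and
`b ≤ 0 < a` if not. For equal directions this gives differences of opposite sign. For opposite
directions the differences become sums, whose signs are opposite because both points lie on the same
side. -/
theorem PerturbedSigns.mul_nonpos {s₁ s₂ t₁ t₂ : Prop} {K a₁ a₂ b₁ b₂ r₁ r₂ : ℝ}
    (h₁ : PerturbedSigns s₁ t₁ K a₁ b₁) (h₂ : PerturbedSigns s₂ t₂ K a₂ b₂)
    (hr₁ : r₁ = 1 ∨ r₁ = -1) (hr₂ : r₂ = 1 ∨ r₂ = -1) (hs : r₁ ≠ r₂ → (s₁ ↔ s₂)) :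
    (r₁ * a₁ - r₂ * a₂) * (r₁ * b₁ - r₂ * b₂) ≤ 0 ∧
      ((r₁ * a₁ - r₂ * a₂) * (r₁ * b₁ - r₂ * b₂) = 0 →
        (s₁ ↔ s₂) ∧ (t₁ ↔ t₂) ∧ (r₁ ≠ r₂ → (s₁ ↔ t₁))) := by
  wlog hs₁ : s₁ generalizing s₁ s₂ t₁ t₂ a₁ a₂ b₁ b₂
  · have := this h₁.swap h₂.swap (fun h => not_congr (hs h)) hs₁
    rw [mul_comm (r₁ * b₁ - r₂ * b₂), not_iff_not, not_iff_not, not_iff_not] at this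
    exact this
  obtain ⟨hb₁, ht₁, ht₁'⟩ := h₁.of_mem hs₁
  have ha₁ : a₁ ≤ 0 := by
    by_cases h : t₁
    · exact (ht₁ h).1.le
    · exact (ht₁' h).1.le
  by_cases hr : r₁ = r₂
  · subst hr
    have hsq : (r₁ * a₁ - r₁ * a₂) * (r₁ * b₁ - r₁ * b₂) = (a₁ - a₂) * (b₁ - b₂) := by
      rcases hr₁ with rfl | rfl <;> ring
    rw [hsq]
    by_cases hs₂ : s₂
    · obtain ⟨hb₂, ht₂, ht₂'⟩ := h₂.of_mem hs₂
      by_cases h : t₁ <;> by_cases h' : t₂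
      · simp [(ht₁ h).1, (ht₂ h').1, hs₁, hs₂, h, h']
      · have := mul_neg_of_pos_of_neg (a := a₁ - a₂) (b := b₁ - b₂)
          (by linarith [(ht₁ h).1, (ht₂' h').1]) (by linarith [(ht₁ h).2, (ht₂' h').2])
        exact ⟨this.le, fun h0 => absurd h0 this.ne⟩
      · have := mul_neg_of_neg_of_pos (a := a₁ - a₂) (b := b₁ - b₂)
          (by linarith [(ht₁' h).1, (ht₂ h').1]) (by linarith [(ht₁' h).2, (ht₂ h').2])
        exact ⟨this.le, fun h0 => absurd h0 this.ne⟩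
      · simp [(ht₁' h).2, (ht₂' h').2, hs₁, hs₂, h, h']
    · obtain ⟨ha₂, ht₂, ht₂'⟩ := h₂.of_notMem hs₂
      have hb₂ : b₂ ≤ 0 := by
        by_cases h : t₂
        · exact (ht₂' h).1.le
        · exact (ht₂ h).1.le
      have := mul_neg_of_neg_of_pos (a := a₁ - a₂) (b := b₁ - b₂) (by linarith) (by linarith)
      exact ⟨this.le, fun h0 => absurd h0 this.ne⟩
  · have hs₂ : s₂ := (hs hr).1 hs₁
    obtain ⟨hb₂, ht₂, ht₂'⟩ := h₂.of_mem hs₂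
    have hsq : (r₁ * a₁ - r₂ * a₂) * (r₁ * b₁ - r₂ * b₂) = (a₁ + a₂) * (b₁ + b₂) := by
      rcases hr₁ with rfl | rfl <;> rcases hr₂ with rfl | rfl <;>
        first | exact absurd rfl hr | ring
    rw [hsq]
    by_cases h : t₁ <;> by_cases h' : t₂
    · simp [(ht₁ h).1, (ht₂ h').1, hs₁, hs₂, h, h']
    · have := mul_neg_of_neg_of_pos (a := a₁ + a₂) (b := b₁ + b₂)
        (by linarith [(ht₂' h').1]) (by linarith)
      exact ⟨this.le, fun h0 => absurd h0 this.ne⟩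
    · have := mul_neg_of_neg_of_pos (a := a₁ + a₂) (b := b₁ + b₂)
        (by linarith [(ht₁' h).1, (ht₂ h').1]) (by linarith)
      exact ⟨this.le, fun h0 => absurd h0 this.ne⟩
    · have := mul_neg_of_neg_of_pos (a := a₁ + a₂) (b := b₁ + b₂)
        (by linarith [(ht₁' h).1, (ht₂' h').1]) (by linarith)
      exact ⟨this.le, fun h0 => absurd h0 this.ne⟩

/-! ### Tree orientations and values of the extended map -/

theorem arcSign_cast_eq (b : Bool) : (arcSign b : ℝ) = 1 ∨ (arcSign b : ℝ) = -1 := by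
  cases b <;> simp [arcSign]

theorem arcSign_cast_injective {b b' : Bool} (h : (arcSign b : ℝ) = arcSign b') : b = b' :=
  arcSign_injective (by exact_mod_cast h)

theorem arcSign_mul_pos {b : Bool} {t : ℝ} (ht : t ≠ 0) (h : b = true ↔ 0 < t) :
    0 < (arcSign b : ℝ) * t := by
  cases b
  · have := lt_of_le_of_ne (not_lt.1 fun h' => Bool.false_ne_true (h.2 h')) ht
    simpa [arcSign] using this
  · simpa [arcSign] using h.1 rfl

theorem arcSign_eq_of_mul_pos {b b' : Bool} {t : ℝ} (h : 0 < (arcSign b : ℝ) * t)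
    (h' : 0 ≤ (arcSign b' : ℝ) * t) : b = b' := by
  cases b <;> cases b' <;> simp [arcSign] at h h' ⊢ <;> linarith

theorem arcSign_reverseOn {E : Type*} (S : Set E) (O : E → Bool) (e : E) :
    (e ∈ S → (arcSign (reverseOn S O e) : ℝ) = -arcSign (O e)) ∧
      (e ∉ S → (arcSign (reverseOn S O e) : ℝ) = arcSign (O e)) := by
  refine ⟨fun h => ?_, fun h => ?_⟩ <;> simp [reverseOn, h, arcSign_not]

theorem eq_of_indicator_arcSign_eq {E : Type*} {X₁ X₂ : Set E} {O : E → Bool}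
    (h : X₁.indicator (fun e => (arcSign (O e) : ℝ)) = X₂.indicator fun e => (arcSign (O e) : ℝ)) :
    X₁ = X₂ := by
  ext e
  have h0 : (arcSign (O e) : ℝ) ≠ 0 := by
    rcases arcSign_cast_eq (O e) with h | h <;> rw [h] <;> norm_num
  have := congrFun h e
  by_cases h1 : e ∈ X₁ <;> by_cases h2 : e ∈ X₂ <;>
    simp only [Set.indicator, h1, h2, if_true, if_false] at this ⊢
  · exact absurd this h0
  · exact absurd this.symm h0

theorem treeOrientation_eq_true_iff (G : OrientedMultigraph V E)
    (σ : Signature G.IsDirectedCycle) (τ : Signature G.IsDirectedCocycle) (T : Set E) (e : E) :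
    G.treeOrientation σ τ T e = true ↔ (e ∉ T ∧ ∃ C, C.1 ⊆ insert e T ∧ σ.dir C e = 1) ∨
      (e ∈ T ∧ ∃ D, D.1 ⊆ insert e Tᶜ ∧ τ.dir D e = 1) := by
  classical
  exact decide_eq_true_iff

variable {G : OrientedMultigraph V E} [Finite V] [Fintype E] {σ : Signature G.IsDirectedCycle}
  {τ : Signature G.IsDirectedCocycle} {w w' : E → ℝ}

theorem IsSpanningTree.mul_treeOrientation_pos {T : Set E} (hT : G.IsSpanningTree T)
    (hw : ∀ C, 0 < w ⬝ᵥ realVec (σ.dir C)) {u : E → ℝ} (hu : u - w ∈ G.cutSpace)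
    (huT : ∀ e ∈ T, u e = 0) {e : E} (he : e ∉ T) :
    0 < (arcSign (G.treeOrientation σ τ T e) : ℝ) * u e := by
  obtain ⟨h0, hiff⟩ := exists_dir_eq_one_iff G.isElementarySystem_cycle
    (fun _ hx _ hy => dotProduct_eq_zero_of_mem hx hy) hw hT.isBasisFor_cycle hu huT he
  refine arcSign_mul_pos h0 ?_
  rw [← hiff, treeOrientation_eq_true_iff]
  simp only [he, not_false_eq_true, true_and, false_and, or_false]

theorem IsSpanningTree.mul_treeOrientation_pos_of_mem {T : Set E} (hT : G.IsSpanningTree T)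
    (hw' : ∀ D, 0 < w' ⬝ᵥ realVec (τ.dir D)) {v : E → ℝ} (hv : v - w' ∈ G.cycleSpace)
    (hvT : ∀ e ∉ T, v e = 0) {e : E} (he : e ∈ T) :
    0 < (arcSign (G.treeOrientation σ τ T e) : ℝ) * v e := by
  obtain ⟨h0, hiff⟩ := exists_dir_eq_one_iff G.isElementarySystem_cocycle
    (fun _ hy _ hx => dotProduct_comm_eq_zero_of_mem hy hx) hw' hT.isBasisFor_cocycle hv hvT
    (e := e) (by simpa using he)
  refine arcSign_mul_pos h0 ?_
  rw [← hiff, treeOrientation_eq_true_iff]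
  simp only [he, not_true_eq_false, true_and, false_and, false_or]

/-- Every compatible orientation comes from a spanning tree. -/
theorem exists_treeOrientation_eq (hG : G.Connected) (hw : ∀ C, 0 < w ⬝ᵥ realVec (σ.dir C))
    (hw' : ∀ D, 0 < w' ⬝ᵥ realVec (τ.dir D)) {O : G.Orientation} (hσ : Compatible σ O)
    (hτ : Compatible τ O) : ∃ T, G.IsSpanningTree T ∧ G.treeOrientation σ τ T = O := by
  obtain ⟨u, v, hu, hv, hu0, hv0, huv⟩ := exists_complementary G.cycleSpace G.cutSpace
    (fun x hx => mem_cycleSpace_of_orthogonal hx) (fun y hy => mem_cutSpace_of_orthogonal hy)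
    (fun x hx y hy => dotProduct_eq_zero_of_mem hx hy) (fun e => (arcSign (O e) : ℝ)) w w'
    (fun x hx hxO => hσ.dotProduct_nonneg G.isElementarySystem_cycle hw hx hxO)
    (fun y hy hyO => hτ.dotProduct_nonneg G.isElementarySystem_cocycle hw' hy hyO)
  have hnonneg : ∀ e, 0 ≤ u e * v e := by
    intro e
    have := mul_nonneg (hu0 e) (hv0 e)
    rcases arcSign_cast_eq (O e) with h | h <;> rw [h] at this <;> linarith
  have hzero : ∀ e, u e * v e = 0 := fun e =>
    (Finset.sum_eq_zero_iff_of_nonneg fun e _ => hnonneg e).1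
      (le_antisymm huv (Finset.sum_nonneg fun e _ => hnonneg e)) e (Finset.mem_univ e)
  -- A cycle inside `T` would pair to zero with `u`, but its chosen direction has the same positive
  -- pairing with `u` as with `w`; dually for a cocycle outside `T`.
  set T : Set E := {e | u e = 0} with hTdef
  have huT : ∀ e ∈ T, u e = 0 := fun e he => he
  have hvT : ∀ e ∉ T, v e = 0 := fun e he => (mul_eq_zero.1 (hzero e)).resolve_left he
  have hT : G.IsSpanningTree T := by
    refine isSpanningTree_of_not_subset hG (fun c hc hsub => ?_) (fun d hd hsub => ?_)
    · obtain ⟨e, he⟩ := Function.ne_iff.1 (G.isElementarySystem_cycle.ne_zero c hc)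
      have := mul_dir_pos G.isElementarySystem_cycle
        (fun _ hx _ hy => dotProduct_eq_zero_of_mem hx hy) hw hu huT
        (C := ⟨_, c, hc, rfl⟩) (e := e) (hsub.trans (Set.subset_insert _ _))
      rw [huT e (hsub he), zero_mul] at this
      exact lt_irrefl _ this
    · obtain ⟨e, he⟩ := Function.ne_iff.1 (G.isElementarySystem_cocycle.ne_zero d hd)
      have := mul_dir_pos G.isElementarySystem_cocycle
        (fun _ hy _ hx => dotProduct_comm_eq_zero_of_mem hy hx) hw' hv (T := Tᶜ) hvT
        (C := ⟨_, d, hd, rfl⟩) (e := e) (hsub.trans (Set.subset_insert _ _))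
      rw [hvT e (hsub he), zero_mul] at this
      exact lt_irrefl _ this
  refine ⟨T, hT, funext fun e => ?_⟩
  by_cases he : e ∈ T
  · exact arcSign_eq_of_mul_pos (hT.mul_treeOrientation_pos_of_mem hw' hv hvT he) (hv0 e)
  · exact arcSign_eq_of_mul_pos (hT.mul_treeOrientation_pos hw hu huT he) (hu0 e)

/-- Every orientation is obtained from a compatible one by reversing disjoint directed cycles and
cocycles. -/
theorem exists_isSubgraphValue (hG : G.Connected) (hw : ∀ C, 0 < w ⬝ᵥ realVec (σ.dir C))
    (hw' : ∀ D, 0 < w' ⬝ᵥ realVec (τ.dir D)) (O : G.Orientation) :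
    ∃ S, G.IsSubgraphValue σ τ O S := by
  classical
  obtain ⟨x, hx, hxv, hxc⟩ := σ.exists_reversal G.isElementarySystem_cycle hw O
  obtain ⟨y, hy, hyv, hyc⟩ := τ.exists_reversal G.isElementarySystem_cocycle hw' O
  have hdis : ∀ {a b : E → ℤ}, a ⬝ᵥ b = 0 → (∀ e, 0 ≤ a e * b e) → ∀ e, a e = 0 ∨ b e = 0 :=
    fun h h' e => mul_eq_zero.1 ((Finset.sum_eq_zero_iff_of_nonneg fun e _ => h' e).1 h e
      (Finset.mem_univ e))
  have hort : ∀ {a b : E → ℤ}, realVec a ∈ G.cycleSpace → realVec b ∈ G.cutSpace →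
      a ⬝ᵥ b = 0 := by
    intro a b ha hb
    have := dotProduct_eq_zero_of_mem ha hb
    simp only [dotProduct, realVec] at this ⊢
    exact_mod_cast this
  -- Orthogonal vectors conforming to one orientation have disjoint supports, as no term of their
  -- product is negative.
  have hxy := hdis (hort hx hy) (fun e => by
    rcases hxv e with h | h <;> rcases hyv e with h' | h' <;> rw [h, h'] <;> simp [mul_self_nonneg])
  set Ocp : G.Orientation := reverseOn (Function.support x ∪ Function.support y) O with hOcp
  have hOx : ∀ e, x e ≠ 0 → x e = arcSign (Ocp e) := by
    intro e he
    rw [hOcp, reverseOn, if_pos (Set.mem_union_left _ he), arcSign_not]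
    exact (hxv e).resolve_left he
  have hOy : ∀ e, y e ≠ 0 → y e = arcSign (Ocp e) := by
    intro e he
    rw [hOcp, reverseOn, if_pos (Set.mem_union_right _ he), arcSign_not]
    exact (hyv e).resolve_left he
  have hOsum : ∀ e, arcSign (Ocp e) = arcSign (O e) + 2 * x e + 2 * y e := by
    intro e
    by_cases h : e ∈ Function.support x ∪ Function.support y
    · rw [hOcp, reverseOn, if_pos h, arcSign_not]
      rcases hxy e with h' | h' <;> rw [h']
      · rcases hyv e with h'' | h''
        · simp [h', h''] at h
        · rw [h'']
          ring
      · rcases hxv e with h'' | h''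
        · simp [h', h''] at h
        · rw [h'']
          ring
    · rw [hOcp, reverseOn, if_neg h]
      rw [Set.mem_union, not_or, Function.mem_support, Function.mem_support, not_not, not_not] at h
      rw [h.1, h.2]
      ring
  have hσO : Compatible σ Ocp := by
    intro c hc hcO
    refine hxc c hc fun e he => ?_
    -- A directed cycle in `Ocp` is likewise disjoint from `y`, so it already lies in the
    -- orientation obtained by reversing `x` alone.
    have hcy := hdis (hort (G.isElementarySystem_cycle.mem c hc) hy) (fun e => by
      by_cases h : c e = 0
      · simp [h]
      by_cases h' : y e = 0
      · simp [h']
      rw [hcO e h, hOy e h']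
      exact mul_self_nonneg _) e
    rw [hcO e he, hOsum e, hcy.resolve_left he]
    ring
  have hτO : Compatible τ Ocp := by
    intro d hd hdO
    refine hyc d hd fun e he => ?_
    have hcx := hdis (hort hx (G.isElementarySystem_cocycle.mem d hd)) (fun e => by
      by_cases h : d e = 0
      · simp [h]
      by_cases h' : x e = 0
      · simp [h']
      rw [hdO e h, hOx e h']
      exact mul_self_nonneg _) e
    rw [hdO e he, hOsum e, hcx.resolve_right he]
    ring
  have hval : ∀ z : E → ℤ, (∀ e, z e ≠ 0 → z e = arcSign (Ocp e)) →
      ∀ e, z e = 0 ∨ z e = 1 ∨ z e = -1 := by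
    intro z hz e
    by_cases h : z e = 0
    · exact Or.inl h
    · rw [hz e h]
      exact Or.inr (arcSign_eq _)
  obtain ⟨𝒞, hC, hCdis, hCx⟩ := G.isElementarySystem_cycle.exists_decomposition hx (hval x hOx)
  obtain ⟨𝒟, hD, hDdis, hDy⟩ := G.isElementarySystem_cocycle.exists_decomposition hy (hval y hOy)
  obtain ⟨T, hT, hTO⟩ := exists_treeOrientation_eq hG hw hw' hσO hτO
  refine ⟨_, Ocp, 𝒞, 𝒟, T, hσO, hτO, fun c hc => ⟨(hC c hc).1, fun e he => ?_⟩,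
    fun d hd => ⟨(hD d hd).1, fun e he => ?_⟩, hCdis, hDdis, ?_, ?_, hT, hTO, rfl⟩
  · have := (hC c hc).2 e he
    rw [this]
    exact hOx e (this ▸ he)
  · have := (hD d hd).2 e he
    rw [this]
    exact hOy e (this ▸ he)
  · rw [hCx, hDy, Set.disjoint_left]
    intro e he he'
    rcases hxy e with h | h
    · exact he h
    · exact he' h
  · rw [hCx, hDy, hOcp]
    funext e
    simp only [reverseOn]
    split_ifs <;> simp

/-- The data witnessing a value of the extended map, in terms of reduced weights. -/
theorem IsSubgraphValue.exists_signs (hw : ∀ C, 0 < w ⬝ᵥ realVec (σ.dir C))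
    (hw' : ∀ D, 0 < w' ⬝ᵥ realVec (τ.dir D)) {O : G.Orientation} {S : Set E}
    (h : G.IsSubgraphValue σ τ O S) :
    ∃ (T X Y : Set E) (u v x y : E → ℝ), G.IsSpanningTree T ∧
      Disjoint X Y ∧ S = (T ∪ X) \ Y ∧ O = reverseOn (X ∪ Y) (G.treeOrientation σ τ T) ∧
      x = X.indicator (fun e => (arcSign (G.treeOrientation σ τ T e) : ℝ)) ∧
      y = Y.indicator (fun e => (arcSign (G.treeOrientation σ τ T e) : ℝ)) ∧
      x ∈ G.cycleSpace ∧ y ∈ G.cutSpace ∧ u - w ∈ G.cutSpace ∧ v - w' ∈ G.cycleSpace ∧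
      ∀ K, (∀ e, |u e| < K ∧ |v e| < K) → ∀ e, PerturbedSigns (e ∈ S) (e ∈ T) K
        (arcSign (O e) * (u e - K * y e)) (arcSign (O e) * (v e - K * x e)) := by
  classical
  obtain ⟨Ocp, 𝒞, 𝒟, T, -, -, hC, hD, hCdis, hDdis, hCD, rfl, hT, rfl, rfl⟩ := h
  obtain ⟨u, hu, huT⟩ :=
    G.isElementarySystem_cocycle.exists_sub_mem_vanishing hT.isBasisFor_cocycle w
  obtain ⟨v, hv, hvT⟩ := G.isElementarySystem_cycle.exists_sub_mem_vanishing (T := Tᶜ)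
    (by rw [compl_compl]; exact hT.isBasisFor_cycle) w'
  refine ⟨T, edgesOf 𝒞, edgesOf 𝒟, u, v, _, _, hT, hCD, rfl, rfl, rfl, rfl,
    G.isElementarySystem_cycle.indicator_edgesOf_mem hC hCdis,
    G.isElementarySystem_cocycle.indicator_edgesOf_mem hD hDdis, hu, hv, fun K hK e => ?_⟩
  have habs : ∀ t : ℝ, |t| < K → (arcSign (G.treeOrientation σ τ T e) : ℝ) * t < K := by
    intro t ht
    rw [abs_lt] at ht
    rcases arcSign_cast_eq (G.treeOrientation σ τ T e) with h | h <;> rw [h] <;> linarith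
  have hrev := arcSign_reverseOn (edgesOf 𝒞 ∪ edgesOf 𝒟) (G.treeOrientation σ τ T) e
  refine perturbedSigns_of_state (x := e ∈ edgesOf 𝒞) (y := e ∈ edgesOf 𝒟)
    (o := (arcSign (G.treeOrientation σ τ T e) : ℝ))
    (fun h => Set.disjoint_left.1 hCD h.1 h.2) (arcSign_cast_eq _) hrev.1 hrev.2 (huT e)
    (fun he => ⟨hT.mul_treeOrientation_pos hw hu huT he, habs _ (hK e).1⟩) (hvT e)
    (fun he => ⟨hT.mul_treeOrientation_pos_of_mem hw' hv hvT he, habs _ (hK e).2⟩)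
    (fun h => ?_) (fun h => ?_) (fun h => ?_) (fun h => ?_)
  · rw [Set.indicator_of_mem h]
  · rw [Set.indicator_of_notMem h, mul_zero]
  · rw [Set.indicator_of_mem h]
  · rw [Set.indicator_of_notMem h, mul_zero]

/-- Two values of the extended map that agree on the edges where the orientations differ come from
the same orientation and coincide. -/
theorem IsSubgraphValue.eq_and_eq (hw : ∀ C, 0 < w ⬝ᵥ realVec (σ.dir C))
    (hw' : ∀ D, 0 < w' ⬝ᵥ realVec (τ.dir D)) {O₁ O₂ : G.Orientation} {S₁ S₂ : Set E}
    (h₁ : G.IsSubgraphValue σ τ O₁ S₁) (h₂ : G.IsSubgraphValue σ τ O₂ S₂)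
    (h : ∀ e, O₁ e ≠ O₂ e → (e ∈ S₁ ↔ e ∈ S₂)) : O₁ = O₂ ∧ S₁ = S₂ := by
  classical
  obtain ⟨T₁, X₁, Y₁, u₁, v₁, x₁, y₁, hT, hd₁, hS₁, hO₁, hxX₁, hyY₁, hx₁, hy₁, hu₁, hv₁, hsg₁⟩ :=
    h₁.exists_signs hw hw'
  obtain ⟨T₂, X₂, Y₂, u₂, v₂, x₂, y₂, -, hd₂, hS₂, hO₂, hxX₂, hyY₂, hx₂, hy₂, hu₂, hv₂, hsg₂⟩ :=
    h₂.exists_signs hw hw'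
  -- Any `K` above all the absolute values of `u₁`, `v₁`, `u₂`, `v₂` would do.
  set K : ℝ := 1 + ∑ e, (|u₁ e| + |v₁ e| + |u₂ e| + |v₂ e|) with hKdef
  have hK : ∀ e, |u₁ e| + |v₁ e| + |u₂ e| + |v₂ e| < K := by
    intro e
    have := Finset.single_le_sum (f := fun e => |u₁ e| + |v₁ e| + |u₂ e| + |v₂ e|)
      (fun e _ => by positivity) (Finset.mem_univ e)
    linarith
  have hsg₁' := hsg₁ K fun e => by
    have := hK e
    constructor <;> linarith [abs_nonneg (u₁ e), abs_nonneg (v₁ e), abs_nonneg (u₂ e),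
      abs_nonneg (v₂ e)]
  have hsg₂' := hsg₂ K fun e => by
    have := hK e
    constructor <;> linarith [abs_nonneg (u₁ e), abs_nonneg (v₁ e), abs_nonneg (u₂ e),
      abs_nonneg (v₂ e)]
  have hU : (u₁ - K • y₁) - (u₂ - K • y₂) ∈ G.cutSpace := by
    convert G.cutSpace.sub_mem (G.cutSpace.sub_mem hu₁ hu₂)
      (G.cutSpace.smul_mem K (G.cutSpace.sub_mem hy₁ hy₂)) using 1
    rw [smul_sub]
    abel
  have hV : (v₁ - K • x₁) - (v₂ - K • x₂) ∈ G.cycleSpace := by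
    convert G.cycleSpace.sub_mem (G.cycleSpace.sub_mem hv₁ hv₂)
      (G.cycleSpace.smul_mem K (G.cycleSpace.sub_mem hx₁ hx₂)) using 1
    rw [smul_sub]
    abel
  have hUV := dotProduct_comm_eq_zero_of_mem hU hV
  have hcancel : ∀ (b : Bool) (t : ℝ), (arcSign b : ℝ) * (arcSign b * t) = t := by
    intro b t
    rcases arcSign_cast_eq b with h | h <;> rw [h] <;> ring
  have hpair : ∀ e, _ := fun e => (hsg₁' e).mul_nonpos (hsg₂' e) (arcSign_cast_eq (O₁ e))
    (arcSign_cast_eq (O₂ e)) fun hne => h e fun heq => hne (by rw [heq])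
  simp only [hcancel] at hpair
  -- A vanishing sum of nonpositive terms: each edge is in the equality case.
  have hterm := (Finset.sum_eq_zero_iff_of_nonpos fun e _ => (hpair e).1).1 hUV
  have hall := fun e => (hpair e).2 (hterm e (Finset.mem_univ e))
  have hS : S₁ = S₂ := Set.ext fun e => (hall e).1
  have hTT : T₁ = T₂ := Set.ext fun e => (hall e).2.1
  subst hTT
  set g := G.treeOrientation σ τ T₁
  have hne : ∀ e, O₁ e ≠ O₂ e → (e ∈ S₁ ↔ e ∈ T₁) := fun e hne =>
    (hall e).2.2 fun heq => hne (arcSign_cast_injective heq)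
  have hrev : ∀ (P Q : Set E) (e : E), ¬ (e ∈ P ↔ e ∈ Q) → reverseOn P g e ≠ reverseOn Q g e := by
    intro P Q e hPQ
    by_cases h1 : e ∈ P <;> by_cases h2 : e ∈ Q <;> simp_all [reverseOn]
  -- Off the common tree the subgraph is `X`, and on the tree it is the complement of `Y`.
  have hloc : ∀ e, ((e ∈ X₁ ↔ e ∈ X₂) ∨ e ∈ T₁) ∧ ((e ∈ Y₁ ↔ e ∈ Y₂) ∨ e ∉ T₁) := by
    intro e
    have h1 := hrev (X₁ ∪ Y₁) (X₂ ∪ Y₂) e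
    rw [← hO₁, ← hO₂] at h1
    have h2 := hne e
    have h3 : e ∈ S₁ ↔ e ∈ S₂ := by rw [hS]
    have h4 : e ∈ X₁ → e ∉ Y₁ := fun h => Set.disjoint_left.1 hd₁ h
    have h5 : e ∈ X₂ → e ∉ Y₂ := fun h => Set.disjoint_left.1 hd₂ h
    rw [hS₂] at h3
    rw [hS₁] at h2 h3
    simp only [Set.mem_union, Set.mem_sdiff] at h1 h2 h3
    clear * - h1 h2 h3 h4 h5
    grind
  -- The circulation `x₁ - x₂` is supported on the tree, hence zero; dually for `Y`.
  have hX : X₁ = X₂ := by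
    refine eq_of_indicator_arcSign_eq (O := g) ?_
    rw [← hxX₁, ← hxX₂, ← sub_eq_zero]
    refine G.isElementarySystem_cycle.eq_zero_of_support_subset hT.isBasisFor_cycle
      (G.cycleSpace.sub_mem hx₁ hx₂) fun e he => ?_
    have := (hloc e).1.resolve_right he
    rw [Pi.sub_apply, hxX₁, hxX₂, Set.indicator, Set.indicator]
    simp [this]
  have hY : Y₁ = Y₂ := by
    refine eq_of_indicator_arcSign_eq (O := g) ?_
    rw [← hyY₁, ← hyY₂, ← sub_eq_zero]
    refine G.isElementarySystem_cocycle.eq_zero_of_support_subset hT.isBasisFor_cocycle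
      (G.cutSpace.sub_mem hy₁ hy₂) fun e he => ?_
    have := (hloc e).2.resolve_right he
    rw [Pi.sub_apply, hyY₁, hyY₂, Set.indicator, Set.indicator]
    simp [this]
  exact ⟨by rw [hO₁, hO₂, hX, hY], hS⟩

end OrientedMultigraph

/-! ### The theorem -/

theorem proposition2p12 {V E : Type*} [Finite V] [Fintype E] (G : OrientedMultigraph V E)
    (hG : G.Connected)
    (σ : OrientedMultigraph.Signature G.IsDirectedCycle)
    (τ : OrientedMultigraph.Signature G.IsDirectedCocycle)
    (hσ : σ.Acyclic) (hτ : τ.Acyclic) :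
    (∀ O : G.Orientation, ∃! S : Set E, G.IsSubgraphValue σ τ O S) ∧
    (∀ O₁ O₂ : G.Orientation, O₁ ≠ O₂ →
      ∃ e : E, O₁ e ≠ O₂ e ∧
        e ∈ symmDiff (G.subgraphMap σ τ O₁) (G.subgraphMap σ τ O₂)) ∧
    Function.Injective (G.subgraphMap σ τ) := by
  obtain ⟨w, hw⟩ := hσ.exists_pos
  obtain ⟨w', hw'⟩ := hτ.exists_pos
  have hex := OrientedMultigraph.exists_isSubgraphValue hG hw hw'
  have hspec : ∀ O, G.IsSubgraphValue σ τ O (G.subgraphMap σ τ O) := fun O =>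
    Classical.epsilon_spec (hex O)
  have hdiff : ∀ O₁ O₂ : G.Orientation, O₁ ≠ O₂ → ∃ e : E, O₁ e ≠ O₂ e ∧
      e ∈ symmDiff (G.subgraphMap σ τ O₁) (G.subgraphMap σ τ O₂) := by
    intro O₁ O₂ hne
    by_contra hcon
    push Not at hcon
    refine hne (OrientedMultigraph.IsSubgraphValue.eq_and_eq hw hw' (hspec O₁) (hspec O₂)
      fun e he => ?_).1
    have := hcon e he
    rw [Set.mem_symmDiff] at this
    tauto
  refine ⟨fun O => ?_, hdiff, fun O₁ O₂ heq => ?_⟩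
  · obtain ⟨S, hS⟩ := hex O
    -- For a single orientation the agreement hypothesis is vacuous, so the value does not depend on
    -- the choices.
    exact ⟨S, hS, fun S' hS' => (OrientedMultigraph.IsSubgraphValue.eq_and_eq hw hw' hS' hS
      fun e he => absurd rfl he).2⟩
  · by_contra hne
    obtain ⟨e, -, he⟩ := hdiff O₁ O₂ hne
    rw [heq, symmDiff_self] at he
    exact he
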